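/- Let $K,m\ge 0$, $x=(x_1,\dots,x_K)$ with $x_k\in\mathbb R^{n_k}$, and consider $$\min\ f(x)=\sum_{k=1}^K\bigl(g_k(A_kx_k)+h_k(x_k)\bigr)\quad\text{subject to}\quad Ex:=\sum_{k=1}^K E_kx_k=q,\quad x_k\in X_k\ (k=1,\dots,K),\qquad(\mathrm P)$$ where $A_k\in\mathbb R^{p_k\times n_k}$, $E_k\in\mathbb R^{m\times n_k}$, $q\in\mathbb R^m$, and $g_k,h_k$ take values in $(-\infty,+\infty]$. Put $X=\prod_kX_k$ and $h(x)=\sum_kh_k(x_k)$. For $\rho>0$ let $$L(x;y)=f(x)+\langle y,q-Ex\rangle+\tfrac{\rho}{2}\|q-Ex\|^2,\qquad d(y)=\min_{x\in X}L(x;y)\quad(y\in\mathbb R^m),$$ and let $Y^*$ be the set of maximizers of $d$. Assume: (a) $f$ is closed; the minimum of $(\mathrm P)$ and the maximum of $d$ are attained; $X\cap\operatorname{int}(\operatorname{dom}f)\cap\{x: Ex=q\}\neq\emptyset$. (b) Each $g_k$ and each $h_k$ is convex, and continuous on its effective domain. (c) Each $g_k$ is strictly convex and continuously differentiable on $\operatorname{int}(\operatorname{dom}g_k)$,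 $A_kX_k\subseteq\operatorname{int}(\operatorname{dom}g_k)$, and there is $L>0$ with $\|A_k^T\nabla g_k(A_kx_k)-A_k^T\nabla g_k(A_kx_k')\|\le L\|x_k-x_k'\|$ for all $k$ and all $x_k,x_k'\in X_k$. (d) Each $h_k$ is of one of the following forms: (1) its epigraph is a polyhedral set; (2) $h_k(x_k)=\lambda_k\|x_k\|_1+\sum_Jw_J\|x_{k,J}\|_2$ with $\lambda_k\ge0$, $w_J\ge0$ and $x_k=(\dots,x_{k,J},\dots)$ a partition of the coordinates of $x_k$; (3) a sum of a function as in (1) and a function as in (2). (e) For all $y\in\mathbb R^m$ and $\xi\in\mathbb R$, $h(x)$ is finite for every $x\in X$ with $L(x;y)\le\xi$. (f) Each $E_k$ has full column rank. (g) Each $X_k$ is a compact polyhedral set. Assume moreover that the level set $\{x: h(x)\le\xi\}$ is polyhedral for every $\xi\in\mathbb R$. Then $d$ is differentiable on $\mathbb R^m$, and for every $\eta\in\mathbb R$, with $\mathcal U=\{y\in\mathbb R^m: d(y)\ge\eta\}$, there are constants $\delta,\tau>0$ such that $$\operatorname{dist}(y,Y^*)\le\tau\,\|\nabla d(y)\|\qquad\text{for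 all }y\in\mathcal U\text{ with }\|\nabla d(y)\|\le\delta .$$ -/

import Mathlib

/-- Polyhedral set: the solution set of finitely many (weak) linear inequalities. -/
def IsPolyhedral {V : Type*} [AddCommGroup V] [Module ℝ V] (S : Set V) : Prop :=
  ∃ (j : ℕ) (a : Fin j → V →ₗ[ℝ] ℝ) (c : Fin j → ℝ), S = {x | ∀ i, c i ≤ a i x}

/-- A function `V → (-∞, +∞]`, given by its effective domain `dom` and its (finite) values there.
The function is `+∞` off `dom`; the numbers `val x` with `x ∉ dom` carry no meaning. -/
structure ExtFun (V : Type*) where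
  dom : Set V
  val : V → ℝ

/-- The epigraph `{(x, t) : φ x ≤ t}`. -/
def ExtFun.epigraph {V : Type*} (φ : ExtFun V) : Set (V × ℝ) :=
  {z | z.1 ∈ φ.dom ∧ φ.val z.1 ≤ z.2}

/-- The level set `{x : φ x ≤ ξ}`. -/
def ExtFun.level {V : Type*} (φ : ExtFun V) (ξ : ℝ) : Set V :=
  {x | x ∈ φ.dom ∧ φ.val x ≤ ξ}

/-- `lam * ‖x‖₁ + ∑ J, w J * ‖x_J‖₂`, where `blk i` is the block `J` that the coordinate `i`
belongs to in the partition of `x`. -/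
noncomputable def groupNorm {n N : ℕ} (lam : ℝ) (w : Fin N → ℝ) (blk : Fin n → Fin N)
    (x : EuclideanSpace ℝ (Fin n)) : ℝ :=
  lam * ∑ i, |x i| + ∑ J, w J * Real.sqrt (∑ i with blk i = J, x i ^ 2)

/-- The admissible nonsmooth parts: polyhedral epigraph, or sparse-group-lasso regularizer,
or the sum of one function of each of these two kinds. -/
def NonsmoothForm {n : ℕ} (h : ExtFun (EuclideanSpace ℝ (Fin n))) : Prop :=
  IsPolyhedral h.epigraph ∨
  (∃ (N : ℕ) (lam : ℝ) (w : Fin N → ℝ) (blk : Fin n → Fin N), 0 ≤ lam ∧ (∀ J, 0 ≤ w J) ∧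
    h.dom = Set.univ ∧ ∀ x, h.val x = groupNorm lam w blk x) ∨
  (∃ (P : ExtFun (EuclideanSpace ℝ (Fin n)))
    (N : ℕ) (lam : ℝ) (w : Fin N → ℝ) (blk : Fin n → Fin N),
    IsPolyhedral P.epigraph ∧ 0 ≤ lam ∧ (∀ J, 0 ≤ w J) ∧
    h.dom = P.dom ∧ ∀ x ∈ h.dom, h.val x = P.val x + groupNorm lam w blk x)

/-- Data of the `K`-block problem
`min ∑ k, (g k (A k (x k)) + h k (x k))` subject to `∑ k, E k (x k) = q`, `x k ∈ X k`,
with block sizes `n k`, and of its augmented Lagrangian with penalty parameter `ρ`.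
Matrices are given as linear maps between Euclidean spaces. -/
structure BlockProblem (K m : ℕ) (n p : Fin K → ℕ) where
  E : ∀ k, EuclideanSpace ℝ (Fin (n k)) →L[ℝ] EuclideanSpace ℝ (Fin m)
  q : EuclideanSpace ℝ (Fin m)
  X : ∀ k, Set (EuclideanSpace ℝ (Fin (n k)))
  A : ∀ k, EuclideanSpace ℝ (Fin (n k)) →L[ℝ] EuclideanSpace ℝ (Fin (p k))
  g : ∀ k, ExtFun (EuclideanSpace ℝ (Fin (p k)))
  h : ∀ k, ExtFun (EuclideanSpace ℝ (Fin (n k)))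
  ρ : ℝ

namespace BlockProblem

variable {K m : ℕ} {n p : Fin K → ℕ}

/-- The space of `x = (x_1, …, x_K)`. -/
abbrev Var (n : Fin K → ℕ) : Type := ∀ k, EuclideanSpace ℝ (Fin (n k))

/-- `E x = E_1 x_1 + ⋯ + E_K x_K`. -/
noncomputable def Ex (Q : BlockProblem K m n p) (x : Var n) : EuclideanSpace ℝ (Fin m) :=
  ∑ k, Q.E k (x k)

/-- `X = X_1 × ⋯ × X_K`. -/
def feas (Q : BlockProblem K m n p) : Set (Var n) := {x | ∀ k, x k ∈ Q.X k}

/-- The nonsmooth part `h(x) = ∑ k, h_k(x_k)`. -/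
noncomputable def hSum (Q : BlockProblem K m n p) : ExtFun (Var n) where
  dom := {x | ∀ k, x k ∈ (Q.h k).dom}
  val := fun x => ∑ k, (Q.h k).val (x k)

/-- The objective `f(x) = ∑ k, (g_k(A_k x_k) + h_k(x_k))`. -/
noncomputable def f (Q : BlockProblem K m n p) : ExtFun (Var n) where
  dom := {x | ∀ k, Q.A k (x k) ∈ (Q.g k).dom ∧ x k ∈ (Q.h k).dom}
  val := fun x => ∑ k, ((Q.g k).val (Q.A k (x k)) + (Q.h k).val (x k))

/-- The augmented Lagrangian `L(x; y)`, for `x ∈ dom f` (elsewhere `L(x; y) = +∞`). -/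
noncomputable def lagr (Q : BlockProblem K m n p) (x : Var n) (y : EuclideanSpace ℝ (Fin m)) : ℝ :=
  Q.f.val x + inner ℝ y (Q.q - Q.Ex x) + Q.ρ / 2 * ‖Q.q - Q.Ex x‖ ^ 2

/-- The augmented dual function `d(y) = min_{x ∈ X} L(x; y)`. -/
noncomputable def dual (Q : BlockProblem K m n p) (y : EuclideanSpace ℝ (Fin m)) : ℝ :=
  sInf ((fun x => Q.lagr x y) '' (Q.feas ∩ Q.f.dom))

/-- `Y*`, the set of maximizers of `d`. -/
def dualOpt (Q : BlockProblem K m n p) : Set (EuclideanSpace ℝ (Fin m)) :=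
  {y | ∀ y', Q.dual y' ≤ Q.dual y}

/-- The level set `{y : d(y) ≥ η}`. -/
def dualLevel (Q : BlockProblem K m n p) (η : ℝ) : Set (EuclideanSpace ℝ (Fin m)) :=
  {y | η ≤ Q.dual y}

/-- The set of primal optimal solutions. -/
def primalOpt (Q : BlockProblem K m n p) : Set (Var n) :=
  {x | (x ∈ Q.feas ∩ Q.f.dom ∧ Q.Ex x = Q.q) ∧
    ∀ x' ∈ Q.feas ∩ Q.f.dom, Q.Ex x' = Q.q → Q.f.val x ≤ Q.f.val x'}

/-- The standing assumptions on the problem. -/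
structure Assumptions (Q : BlockProblem K m n p) : Prop where
  /-- `f` is a closed function. -/
  closed_f : IsClosed Q.f.epigraph
  /-- The primal minimum is attained. -/
  primal_attained : Q.primalOpt.Nonempty
  /-- The dual maximum is attained. -/
  dual_attained : Q.dualOpt.Nonempty
  /-- `X ∩ int (dom f) ∩ {x | E x = q}` is nonempty. -/
  qualification : (Q.feas ∩ interior Q.f.dom ∩ {x | Q.Ex x = Q.q}).Nonempty
  convex_g : ∀ k, ConvexOn ℝ (Q.g k).dom (Q.g k).val
  continuous_g : ∀ k, ContinuousOn (Q.g k).val (Q.g k).dom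
  convex_h : ∀ k, ConvexOn ℝ (Q.h k).dom (Q.h k).val
  continuous_h : ∀ k, ContinuousOn (Q.h k).val (Q.h k).dom
  strictConvex_g : ∀ k, StrictConvexOn ℝ (interior (Q.g k).dom) (Q.g k).val
  contDiff_g : ∀ k, ContDiffOn ℝ 1 (Q.g k).val (interior (Q.g k).dom)
  /-- `∇ g_k (A_k x_k)` makes sense for all `x_k ∈ X_k`. -/
  map_X : ∀ k, ∀ x ∈ Q.X k, Q.A k x ∈ interior (Q.g k).dom
  /-- `x_k ↦ A_kᵀ ∇ g_k (A_k x_k)` is Lipschitz continuous on `X_k`, uniformly in `k`. -/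
  lipschitz_g : ∃ L : ℝ, 0 < L ∧ ∀ k, ∀ x ∈ Q.X k, ∀ x' ∈ Q.X k,
    ‖(Q.A k).adjoint (gradient (Q.g k).val (Q.A k x)) -
      (Q.A k).adjoint (gradient (Q.g k).val (Q.A k x'))‖ ≤ L * ‖x - x'‖
  nonsmooth_h : ∀ k, NonsmoothForm (Q.h k)
  /-- `h` is finite on `{x | L(x; y) ≤ ξ} ∩ X` (here `L(x; y) ≤ ξ` includes `x ∈ dom f`). -/
  finite_h : ∀ (y : EuclideanSpace ℝ (Fin m)) (ξ : ℝ), ∀ x ∈ Q.feas, x ∈ Q.f.dom →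
    Q.lagr x y ≤ ξ → x ∈ Q.hSum.dom
  /-- Each `E_k` has full column rank. -/
  fullColumnRank : ∀ k, Function.Injective (Q.E k)
  compact_X : ∀ k, IsCompact (Q.X k)
  polyhedral_X : ∀ k, IsPolyhedral (Q.X k)

end BlockProblem

/-! A Euclidean norm of two or more coordinates has curved level sets, so if the level sets of `h`
are polyhedral, every group of positive weight can have only one coordinate. Each `h_k` then has a
polyhedral epigraph (`NonsmoothForm.isPolyhedral_epigraph`). Passing to epigraph variables `(x_k,
t_k)` turns the problem into a smooth convex program over a polytope with the same augmented dual
function (`Assumptions.exists_polytopeProgram`).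

For such a program, `∇d(y) = r = q - E z` for any minimizer `z` at `y`, and `z` minimizes the linear
form `DF z - ⟪y + ρ r, E ·⟫` on the polytope, hence lies in the face spanned by the vertices `W`
minimizing it. Fix a primal solution `z₀`. By cocoercivity (`sq_sub_le`), replacing `DF z` by `DF
z₀` costs at most `m`, where `m²` is a multiple of `dist(y, Y*) ‖r‖`. So `y + ρ r` almost solves the
finite linear system saying that `W` minimizes the form built from `DF z₀`, and Hoffman's bound
gives an exact solution `y'` within `κ m`. For small `r` the face of `W` contains a feasible point,
which makes `y'` a dual maximizer (`IsDual.forall_le_of_face`). Thus `dist(y, Y*) ≤ κ m + ρ ‖r‖`,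
and the square root in `m` is absorbed into the left side. Since `Y*` may be unbounded, smallness of
`m` rests on `IsDual.exists_norm_sub_le`: superlevel sets of `d` stay within bounded distance of
`Y*`. -/

open scoped RealInnerProductSpace

/-! ### Hoffman's error bound and its stability under small perturbations. -/

section Hoffman

variable {Y : Type*} [NormedAddCommGroup Y] [InnerProductSpace ℝ Y] [FiniteDimensional ℝ Y]
  {ι : Type*} [Finite ι]

/-- Vectors in the polar of the cone `{d | ∀ i ∈ I, ⟪a i, d⟫ ≤ 0}` are controlled by their inner
products with the generators `a i`, `i ∈ I`. -/
theorem exists_norm_le_of_mem_polar (a : ι → Y) (I : Set ι) :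
    ∃ κ : ℝ, 0 < κ ∧ ∀ u : Y, (∀ d : Y, (∀ i ∈ I, ⟪a i, d⟫ ≤ 0) → ⟪u, d⟫ ≤ 0) →
      ∀ M : ℝ, 0 ≤ M → (∀ i ∈ I, ⟪a i, u⟫ ≤ M) → ‖u‖ ≤ κ * M := by
  classical
  have := Fintype.ofFinite ι
  set N : Set Y := {u | ∀ d : Y, (∀ i ∈ I, ⟪a i, d⟫ ≤ 0) → ⟪u, d⟫ ≤ 0} with hN
  have hNc : IsClosed N := by
    simp only [hN, Set.ofPred_forall]
    refine isClosed_iInter fun d => isClosed_iInter fun _ => ?_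
    exact isClosed_le (by fun_prop) continuous_const
  -- On the polar cone `N`, `φ` vanishes only at `0`: if `φ u = 0`, then `u` itself is an admissible
  -- `d`, so `⟪u, u⟫ ≤ 0`. The minimum over unit vectors of `N` is therefore positive.
  set φ : Y → ℝ := fun u => ∑ i with i ∈ I, max ⟪a i, u⟫ 0 with hφ
  have hφc : Continuous φ := by
    refine continuous_finsetSum _ fun i _ => ?_
    fun_prop
  have hφle : ∀ u M, 0 ≤ M → (∀ i ∈ I, ⟪a i, u⟫ ≤ M) → φ u ≤ Fintype.card ι * M := by
    intro u M hM h
    calc φ u ≤ ∑ i with i ∈ I, M :=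
          Finset.sum_le_sum fun i hi => max_le (h i (by simpa using hi)) hM
      _ ≤ ∑ i : ι, M := Finset.sum_le_sum_of_subset_of_nonneg (Finset.filter_subset _ _)
          (fun _ _ _ => hM)
      _ = Fintype.card ι * M := by simp
  have hK : IsCompact (N ∩ Metric.sphere 0 1) := (isCompact_sphere 0 1).inter_left hNc
  obtain ⟨c, hc, hcφ⟩ : ∃ c : ℝ, 0 < c ∧ ∀ u ∈ N ∩ Metric.sphere 0 1, c ≤ φ u := by
    rcases (N ∩ Metric.sphere (0 : Y) 1).eq_empty_or_nonempty with h | h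
    · exact ⟨1, one_pos, by simp [h]⟩
    · obtain ⟨u, hu, hmin⟩ := hK.exists_isMinOn h hφc.continuousOn
      refine ⟨φ u, ?_, fun v hv => hmin hv⟩
      have h0 : 0 ≤ φ u := Finset.sum_nonneg fun i _ => le_max_right _ _
      rcases h0.lt_or_eq with h1 | h1
      · exact h1
      · exfalso
        have h2 := (Finset.sum_eq_zero_iff_of_nonneg (fun i _ => le_max_right _ _)).1 h1.symm
        have h3 := hu.1 u fun i hi => by
          have := h2 i (by simpa using hi)
          exact (le_max_left _ _).trans this.le
        have h4 : ‖u‖ = 1 := by simpa using hu.2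
        rw [real_inner_self_eq_norm_sq, h4] at h3
        norm_num at h3
  refine ⟨(Fintype.card ι + 1) / c, by positivity, fun u hu M hM hle => ?_⟩
  rcases eq_or_ne u 0 with rfl | hu0
  · simp only [norm_zero]; positivity
  have hpos : 0 < ‖u‖ := norm_pos_iff.2 hu0
  have h1 : ‖u‖⁻¹ • u ∈ N ∩ Metric.sphere 0 1 := by
    refine ⟨fun d hd => ?_, by simp [norm_smul, hpos.ne']⟩
    rw [real_inner_smul_left]
    exact mul_nonpos_of_nonneg_of_nonpos (by positivity) (hu d hd)
  have h2 := (hcφ _ h1).trans (hφle _ (‖u‖⁻¹ * M) (by positivity) fun i hi => by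
    rw [real_inner_smul_right]
    exact mul_le_mul_of_nonneg_left (hle i hi) (by positivity))
  have h3 : c * ‖u‖ ≤ Fintype.card ι * M := by
    calc c * ‖u‖ ≤ (Fintype.card ι * (‖u‖⁻¹ * M)) * ‖u‖ := by gcongr
      _ = Fintype.card ι * M := by field_simp
  rw [div_mul_eq_mul_div, le_div_iff₀ hc]
  nlinarith

/-- **Hoffman's error bound** for systems of linear inequalities, uniform in the right-hand side. -/
theorem exists_hoffman_constant (a : ι → Y) :
    ∃ κ : ℝ, 0 < κ ∧ ∀ (b : ι → ℝ) (M : ℝ) (y : Y), 0 ≤ M → (∃ y₀, ∀ i, ⟪a i, y₀⟫ ≤ b i) →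
      (∀ i, ⟪a i, y⟫ ≤ b i + M) → ∃ y', (∀ i, ⟪a i, y'⟫ ≤ b i) ∧ ‖y - y'‖ ≤ κ * M := by
  choose κ hκ0 hκ using exists_norm_le_of_mem_polar a
  obtain ⟨κm, hκm⟩ := (Set.finite_range κ).bddAbove
  refine ⟨κm, (hκ0 ∅).trans_le (hκm ⟨∅, rfl⟩), fun b M y hM hne hy => ?_⟩
  set S : Set Y := {y | ∀ i, ⟪a i, y⟫ ≤ b i} with hS
  have hSc : IsClosed S := by
    simp only [hS, Set.ofPred_forall]
    exact isClosed_iInter fun i => isClosed_le (by fun_prop) continuous_const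
  have hSconv : Convex ℝ S := by
    intro u hu v hv s t hs ht hst i
    have := hu i
    have := hv i
    rw [inner_add_right, real_inner_smul_right, real_inner_smul_right]
    calc s * ⟪a i, u⟫ + t * ⟪a i, v⟫ ≤ s * b i + t * b i := by gcongr
      _ = b i := by rw [← add_mul, hst, one_mul]
  obtain ⟨y', hy', hmin⟩ := exists_norm_eq_iInf_of_complete_convex
    (show S.Nonempty from hne) hSc.isComplete hSconv y
  rw [norm_eq_iInf_iff_real_inner_le_zero hSconv hy'] at hmin
  refine ⟨y', hy', ?_⟩
  -- Active constraints at the projection `y'`: a direction not increasing them can be followed a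
  -- little inside `S`, so `y - y'` is in their polar. Taking `κm` over all subsets makes the
  -- constant independent of `b`.
  set I : Set ι := {i | ⟪a i, y'⟫ = b i}
  refine (hκ I (y - y') (fun d hd => ?_) M hM fun i hi => ?_).trans
    (mul_le_mul_of_nonneg_right (hκm ⟨I, rfl⟩) hM)
  · have hev : ∀ᶠ s : ℝ in nhdsWithin 0 (Set.Ioi 0), ∀ i, ⟪a i, y' + s • d⟫ ≤ b i := by
      refine Filter.eventually_all.2 fun i => ?_
      by_cases hi : ⟪a i, y'⟫ = b i
      · filter_upwards [self_mem_nhdsWithin] with s hs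
        rw [inner_add_right, real_inner_smul_right, hi]
        have := mul_nonpos_of_nonneg_of_nonpos (le_of_lt hs) (hd i hi)
        linarith
      · have hlt : ⟪a i, y' + (0 : ℝ) • d⟫ < b i := by
          simpa using lt_of_le_of_ne (hy' i) hi
        have hc : Continuous fun s : ℝ => ⟪a i, y' + s • d⟫ := by fun_prop
        exact ((hc.tendsto 0).eventually_lt_const hlt).filter_mono nhdsWithin_le_nhds
          |>.mono fun s hs => hs.le
    obtain ⟨s, hs, hs0⟩ := (hev.and self_mem_nhdsWithin).exists
    have h1 := hmin _ hs
    rw [add_sub_cancel_left, real_inner_smul_right] at h1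
    exact nonpos_of_mul_nonpos_right h1 hs0
  · have h1 := hy i
    have h2 : ⟪a i, y'⟫ = b i := hi
    rw [inner_sub_right]
    linarith

/-- Small perturbations of a system of linear inequalities: approximate solutions are
close to exact solutions, and there are none when the exact system is infeasible. -/
theorem exists_local_hoffman_constant (a : ι → Y) (b : ι → ℝ) :
    ∃ κ ε : ℝ, 0 < κ ∧ 0 < ε ∧ ∀ (M : ℝ) (y : Y), 0 ≤ M → M ≤ ε →
      (∀ i, ⟪a i, y⟫ ≤ b i + M) → ∃ y', (∀ i, ⟪a i, y'⟫ ≤ b i) ∧ ‖y - y'‖ ≤ κ * M := by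
  classical
  have := Fintype.ofFinite ι
  obtain ⟨κ, hκ, h⟩ := exists_hoffman_constant a
  by_cases hne : ∃ y₀, ∀ i, ⟪a i, y₀⟫ ≤ b i
  · exact ⟨κ, 1, hκ, one_pos, fun M y hM _ hy => h b M y hM hne hy⟩
  -- Infeasible case. If the system relaxed by `M` had a solution, it would have one in the ball of
  -- radius `κ * R`, since `0` violates it by at most `R`. On that ball the total violation `φ` has
  -- a positive minimum, which excludes small `M`.
  set R : ℝ := ∑ i, |b i| with hR
  have hR0 : 0 ≤ R := Finset.sum_nonneg fun i _ => abs_nonneg _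
  have hRb : ∀ i, |b i| ≤ R := fun i =>
    Finset.single_le_sum (f := fun i => |b i|) (fun i _ => abs_nonneg _) (Finset.mem_univ i)
  set φ : Y → ℝ := fun y => ∑ i, max (⟪a i, y⟫ - b i) 0 with hφ
  have hφc : Continuous φ := by
    refine continuous_finsetSum _ fun i _ => ?_
    fun_prop
  obtain ⟨y₁, -, hmin⟩ := (isCompact_closedBall (0 : Y) (κ * R)).exists_isMinOn
    ⟨0, by simp; positivity⟩ hφc.continuousOn
  have hpos : 0 < φ y₁ := by
    have h0 : 0 ≤ φ y₁ := Finset.sum_nonneg fun i _ => le_max_right _ _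
    rcases h0.lt_or_eq with h1 | h1
    · exact h1
    · exfalso
      have h2 := (Finset.sum_eq_zero_iff_of_nonneg (fun i _ => le_max_right _ _)).1 h1.symm
      refine hne ⟨y₁, fun i => ?_⟩
      have := (le_max_left (⟪a i, y₁⟫ - b i) 0).trans (h2 i (Finset.mem_univ i)).le
      linarith
  refine ⟨κ, φ y₁ / (Fintype.card ι + 1), hκ, by positivity, fun M y hM hMε hy => ?_⟩
  exfalso
  obtain ⟨y', hy', hn⟩ := h (fun i => b i + M) R 0 hR0 ⟨y, hy⟩ fun i => by
    have := hRb i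
    have := neg_abs_le (b i)
    simp only [inner_zero_right]
    linarith
  have h1 : φ y₁ ≤ φ y' := hmin (by simpa using hn)
  have h2 : φ y' ≤ Fintype.card ι * M := by
    calc φ y' ≤ ∑ i : ι, M := Finset.sum_le_sum fun i _ => max_le (by linarith [hy' i]) hM
      _ = Fintype.card ι * M := by simp
  rw [le_div_iff₀ (by positivity)] at hMε
  have h3 : M = 0 := by nlinarith
  rw [h3, mul_zero] at h2
  linarith

end Hoffman

/-! ### Elementary facts on quadratics, faces and finite families. -/

/-- If `s * a + s ^ 2 * k` is nonnegative for all small `s > 0`, then `a` is nonnegative. -/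
theorem nonneg_of_forall_mul_add_sq_mul_nonneg {a k : ℝ} (hk : 0 < k)
    (h : ∀ s : ℝ, 0 < s → s ≤ 1 → 0 ≤ s * a + s ^ 2 * k) : 0 ≤ a := by
  by_contra! ha
  set s := min 1 (-a / (2 * k)) with hs
  have hs0 : 0 < s := lt_min one_pos (div_pos (by linarith) (by positivity))
  have h1 := h s hs0 (min_le_left _ _)
  have h2 : s * (2 * k) ≤ -a := (le_div_iff₀ (by positivity)).1 (min_le_right _ _)
  nlinarith

/-- A point of a polytope that minimizes a linear functional is a convex combination of the
vertices that minimize it. -/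
theorem mem_convexHull_filter_of_le {Z : Type*} [AddCommGroup Z] [Module ℝ Z] {V : Finset Z}
    (l : Z →ₗ[ℝ] ℝ) {z : Z} (hz : z ∈ convexHull ℝ (V : Set Z)) (hl : ∀ v ∈ V, l z ≤ l v)
    (W : Finset Z) (hW : ∀ v ∈ V, l v = l z → v ∈ W) : z ∈ convexHull ℝ (W : Set Z) := by
  classical
  rw [Finset.mem_convexHull'] at hz
  obtain ⟨w, hw0, hw1, hwz⟩ := hz
  have h1 : ∑ v ∈ V, w v * (l v - l z) = 0 := by
    have : l z = ∑ v ∈ V, w v * l v := by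
      conv_lhs => rw [← hwz]
      simp
    simp only [mul_sub, Finset.sum_sub_distrib, ← Finset.sum_mul, hw1, ← this]
    ring
  have h2 := (Finset.sum_eq_zero_iff_of_nonneg fun v hv =>
    mul_nonneg (hw0 v hv) (sub_nonneg.2 (hl v hv))).1 h1
  rw [← hwz]
  have h3 : ∀ v ∈ V, v ∉ V.filter (fun v => w v ≠ 0) → w v = 0 := by
    intro v hv hv'
    by_contra h
    exact hv' (Finset.mem_filter.2 ⟨hv, h⟩)
  rw [← Finset.sum_subset (Finset.filter_subset (fun v => w v ≠ 0) V)
    (fun v hv hv' => by rw [h3 v hv hv', zero_smul])]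
  refine (convex_convexHull ℝ _).sum_mem (fun v hv => hw0 v (Finset.filter_subset _ _ hv)) ?_
    fun v hv => subset_convexHull ℝ _ ?_
  · rw [Finset.sum_subset (Finset.filter_subset _ V) h3, hw1]
  · rw [Finset.mem_filter] at hv
    refine hW v hv.1 ?_
    have := (mul_eq_zero.1 (h2 v hv.1)).resolve_left hv.2
    linarith

theorem Finset.exists_pos_forall_le {α : Type*} (s : Finset α) (ε : α → ℝ)
    (hε : ∀ a, 0 < ε a) : ∃ e : ℝ, 0 < e ∧ ∀ a ∈ s, e ≤ ε a := by
  have h : ∀ᶠ e : ℝ in nhdsWithin 0 (Set.Ioi 0), ∀ a ∈ s, e ≤ ε a :=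
    (Filter.eventually_all_finset s).2 fun a _ => by
      filter_upwards [Ioo_mem_nhdsGT (hε a)] with e he using he.2.le
  obtain ⟨e, he, he0⟩ := (h.and self_mem_nhdsWithin).exists
  exact ⟨e, he0, he⟩

/-! ### Augmented Lagrangian duality over a polytope. -/

/-- Data of a smooth convex program over the convex hull of the finite set `V`, with the linear
constraint `E z = q`. The objective `F` has the derivative `DF` in the directions
pointing into the polytope, which enters only through the gradient inequality and a quadratic
upper bound. -/
structure PolytopeProgram (Z Y : Type*) [AddCommGroup Z] [Module ℝ Z] [NormedAddCommGroup Y]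
    [InnerProductSpace ℝ Y] where
  V : Finset Z
  E : Z →ₗ[ℝ] Y
  q : Y
  ρ : ℝ
  F : Z → ℝ
  DF : Z → Z →ₗ[ℝ] ℝ
  M : ℝ
  ρ_pos : 0 < ρ
  M_pos : 0 < M
  add_le : ∀ z ∈ convexHull ℝ (V : Set Z), ∀ w ∈ convexHull ℝ (V : Set Z),
    F z + DF z (w - z) ≤ F w
  le_add : ∀ z ∈ convexHull ℝ (V : Set Z), ∀ w ∈ convexHull ℝ (V : Set Z), ∀ s : ℝ,
    0 ≤ s → s ≤ 1 → F (z + s • (w - z)) ≤ F z + s * DF z (w - z) + M * s ^ 2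

namespace PolytopeProgram

variable {Z Y : Type*} [AddCommGroup Z] [Module ℝ Z] [NormedAddCommGroup Y]
    [InnerProductSpace ℝ Y] (T : PolytopeProgram Z Y)

/-- The feasible polytope. -/
def C : Set Z := convexHull ℝ (T.V : Set Z)

/-- The augmented Lagrangian. -/
noncomputable def augL (z : Z) (y : Y) : ℝ :=
  T.F z + ⟪y, T.q - T.E z⟫ + T.ρ / 2 * ‖T.q - T.E z‖ ^ 2

/-- `z` minimizes the augmented Lagrangian at `y`. -/
def IsMinimizer (y : Y) (z : Z) : Prop := z ∈ T.C ∧ ∀ w ∈ T.C, T.augL z y ≤ T.augL w y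

variable {T}

theorem convex_C : Convex ℝ T.C := convex_convexHull ℝ _

/-- First-order optimality along the segment from `z` to `w`, the remainder being quadratic in `s`.
-/
theorem IsMinimizer.inner_le {y : Y} {z : Z} (hz : T.IsMinimizer y z) {w : Z} (hw : w ∈ T.C) :
    ⟪y + T.ρ • (T.q - T.E z), T.E (w - z)⟫ ≤ T.DF z (w - z) := by
  rw [← sub_nonneg]
  have hρ := T.ρ_pos
  have hM := T.M_pos
  refine nonneg_of_forall_mul_add_sq_mul_nonneg
    (k := T.M + T.ρ / 2 * ‖T.E (w - z)‖ ^ 2) (by positivity) fun s hs0 hs1 => ?_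
  have h1 := hz.2 _ (convex_C.add_smul_sub_mem hz.1 hw ⟨hs0.le, hs1⟩)
  have h2 := T.le_add z hz.1 w hw s hs0.le hs1
  have h3 : T.q - T.E (z + s • (w - z)) = (T.q - T.E z) - s • T.E (w - z) := by
    simp only [map_add, map_smul]; abel
  unfold augL at h1
  rw [h3, norm_sub_sq_real (T.q - T.E z), inner_sub_right y (T.q - T.E z), norm_smul,
    real_inner_smul_right,
    real_inner_smul_right, mul_pow, Real.norm_eq_abs, sq_abs] at h1
  rw [inner_add_left, real_inner_smul_left]
  linarith

/-- First-order optimality is also sufficient because `F` is convex; the extra growth comes from the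
quadratic penalty. -/
theorem augL_add_le {y : Y} {z w : Z} (hz : z ∈ T.C) (hw : w ∈ T.C)
    (h : ⟪y + T.ρ • (T.q - T.E z), T.E (w - z)⟫ ≤ T.DF z (w - z)) :
    T.augL z y + T.ρ / 2 * ‖T.E (w - z)‖ ^ 2 ≤ T.augL w y := by
  have h2 := T.add_le z hz w hw
  have h3 : T.q - T.E w = (T.q - T.E z) - T.E (w - z) := by simp
  unfold augL
  rw [h3, norm_sub_sq_real (T.q - T.E z), inner_sub_right y (T.q - T.E z)]
  rw [inner_add_left, real_inner_smul_left] at h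
  linarith

theorem IsMinimizer.mono {y : Y} {z : Z} (hz : T.IsMinimizer y z) {w : Z} (hw : w ∈ T.C) :
    T.augL z y + T.ρ / 2 * ‖T.E (w - z)‖ ^ 2 ≤ T.augL w y :=
  augL_add_le hz.1 hw (hz.inner_le hw)

theorem augL_sub (z : Z) (y y' : Y) : T.augL z y' - T.augL z y = ⟪y' - y, T.q - T.E z⟫ := by
  unfold augL
  rw [inner_sub_left]
  ring

/-- Sum of the two growth inequalities. With `y = y'` it shows that `E z` does not depend on the
choice of minimizer. -/
theorem IsMinimizer.norm_sub_le {y y' : Y} {z z' : Z} (hz : T.IsMinimizer y z)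
    (hz' : T.IsMinimizer y' z') : T.ρ * ‖T.E z - T.E z'‖ ≤ ‖y - y'‖ := by
  have h1 := hz.mono hz'.1
  have h2 := hz'.mono hz.1
  have h3 := T.augL_sub z y y'
  have h4 := T.augL_sub z' y y'
  rw [map_sub] at h1 h2
  rw [norm_sub_rev] at h1
  have h5 : ⟪y' - y, T.q - T.E z⟫ - ⟪y' - y, T.q - T.E z'⟫ = ⟪y - y', T.E z - T.E z'⟫ := by
    simp only [inner_sub_left, inner_sub_right]; ring
  have h6 := real_inner_le_norm (y - y') (T.E z - T.E z')
  have h7 : T.ρ * ‖T.E z - T.E z'‖ * ‖T.E z - T.E z'‖ ≤ ‖y - y'‖ * ‖T.E z - T.E z'‖ := by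
    nlinarith
  rcases (norm_nonneg (T.E z - T.E z')).eq_or_lt with h | h
  · rw [← h]; simp
  · exact le_of_mul_le_mul_right h7 h

variable (T) in
/-- `d` is the augmented dual function, with attained minima. -/
def IsDual (d : Y → ℝ) : Prop := ∀ y, ∃ z, T.IsMinimizer y z ∧ d y = T.augL z y

theorem IsDual.eq_augL {d : Y → ℝ} (hd : T.IsDual d) {y : Y} {z : Z} (hz : T.IsMinimizer y z) :
    d y = T.augL z y := by
  obtain ⟨w, hw, h⟩ := hd y
  exact h.trans (le_antisymm (hw.2 z hz.1) (hz.2 w hw.1))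

theorem IsDual.le_augL {d : Y → ℝ} (hd : T.IsDual d) (y : Y) {z : Z} (hz : z ∈ T.C) :
    d y ≤ T.augL z y := by
  obtain ⟨w, hw, h⟩ := hd y
  exact h ▸ hw.2 z hz

/-- Testing each minimizer at the other multiplier squeezes `d y' - d y` between `⟪y' - y, q - E
z'⟫` and `⟪y' - y, q - E z⟫`, which differ by `O(‖y' - y‖ ^ 2)`. -/
theorem IsDual.hasGradientAt [CompleteSpace Y] {d : Y → ℝ} (hd : T.IsDual d) {y : Y} {z : Z}
    (hz : T.IsMinimizer y z) : HasGradientAt d (T.q - T.E z) y := by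
  rw [hasGradientAt_iff_isLittleO]
  refine Asymptotics.IsBigO.trans_isLittleO ?_
    (Asymptotics.isLittleO_pow_sub_sub y (m := 2) one_lt_two)
  refine Asymptotics.IsBigO.of_bound (1 / T.ρ) (Filter.Eventually.of_forall fun y' => ?_)
  obtain ⟨z', hz', -⟩ := hd y'
  have h1 : d y' - d y ≤ ⟪y' - y, T.q - T.E z⟫ := by
    rw [← augL_sub, ← hd.eq_augL hz]
    linarith [hd.le_augL y' hz.1]
  have h2 : ⟪y' - y, T.q - T.E z'⟫ ≤ d y' - d y := by
    rw [← augL_sub, ← hd.eq_augL hz']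
    linarith [hd.le_augL y hz'.1]
  have h3 := hz.norm_sub_le hz'
  have h4 : ⟪y' - y, T.q - T.E z⟫ - ⟪y' - y, T.q - T.E z'⟫ = ⟪y - y', T.E z - T.E z'⟫ := by
    simp only [inner_sub_left, inner_sub_right]; ring
  have h5 := real_inner_le_norm (y - y') (T.E z - T.E z')
  have hρ := T.ρ_pos
  have h6 : ‖y - y'‖ * ‖T.E z - T.E z'‖ ≤ 1 / T.ρ * ‖y - y'‖ ^ 2 := by
    rw [one_div_mul_eq_div, le_div_iff₀ hρ]
    nlinarith [norm_nonneg (y - y')]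
  rw [norm_pow, norm_norm, Real.norm_eq_abs, norm_sub_rev y' y, abs_le,
    real_inner_comm]
  constructor
  · linarith
  · have : 0 ≤ 1 / T.ρ * ‖y - y'‖ ^ 2 := by positivity
    linarith

theorem IsDual.forall_le_iff [CompleteSpace Y] {d : Y → ℝ} (hd : T.IsDual d) {y : Y} {z : Z}
    (hz : T.IsMinimizer y z) : (∀ y', d y' ≤ d y) ↔ T.E z = T.q := by
  constructor
  · intro h
    have h1 : IsLocalMax d y := Filter.Eventually.of_forall h
    have h2 := h1.hasFDerivAt_eq_zero (hd.hasGradientAt hz).hasFDerivAt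
    rw [map_eq_zero_iff _ (LinearIsometryEquiv.injective _), sub_eq_zero] at h2
    exact h2.symm
  · intro h y'
    have h1 := hd.le_augL y' hz.1
    have h2 := T.augL_sub z y y'
    rw [h, sub_self, inner_zero_right] at h2
    rw [hd.eq_augL hz]
    linarith

/-- The Lagrangian at a feasible `z₀` does not depend on `y`. One fixed `z₀`, and one linear form
`DF z₀`, thus serves all dual maximizers. -/
theorem IsDual.isMinimizer_of_forall_le {d : Y → ℝ} (hd : T.IsDual d) {y₀ y₁ : Y} {z₀ : Z}
    (hz₀ : T.IsMinimizer y₀ z₀) (hE : T.E z₀ = T.q) (hy₁ : ∀ y, d y ≤ d y₁) :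
    T.IsMinimizer y₁ z₀ := by
  refine ⟨hz₀.1, fun w hw => ?_⟩
  have h1 := hy₁ y₀
  have h2 := hd.le_augL y₁ hw
  have h3 := T.augL_sub z₀ y₀ y₁
  rw [hE, sub_self, inner_zero_right] at h3
  rw [hd.eq_augL hz₀] at h1
  linarith

/-- Cocoercivity of the gradient in the directions of the polytope. -/
theorem sq_sub_le {x y u v : Z} (hx : x ∈ T.C) (hy : y ∈ T.C) (hu : u ∈ T.C) (hv : v ∈ T.C) :
    ((T.DF x - T.DF y) (u - v)) ^ 2 ≤ 18 * T.M * (T.DF x - T.DF y) (x - y) := by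
  have hM := T.M_pos
  -- Compare the values at `y + s • (u - y)`: bounded above quadratically from `y`, below by the
  -- tangent at `x`.
  have key : ∀ x ∈ T.C, ∀ y ∈ T.C, ∀ s : ℝ, 0 ≤ s → s ≤ 1 → ∀ u ∈ T.C,
      s * (T.DF x - T.DF y) (u - y) ≤ (T.DF x - T.DF y) (x - y) + T.M * s ^ 2 := by
    intro x hx y hy s hs0 hs1 u hu
    have h1 := T.le_add y hy u hu s hs0 hs1
    have h2 := T.add_le x hx _ (convex_C.add_smul_sub_mem hy hu ⟨hs0, hs1⟩)
    have h3 := T.add_le y hy x hx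
    have e1 : T.DF x (y + s • (u - y) - x) = s * T.DF x (u - y) - T.DF x (x - y) := by
      simp only [map_sub, map_add, map_smul, smul_eq_mul]; ring
    simp only [LinearMap.sub_apply]
    linarith
  set D := T.DF x - T.DF y with hD
  set B := D (x - y) with hB
  have hB0 : 0 ≤ B := by
    have h1 := T.add_le x hx y hy
    have h2 := T.add_le y hy x hx
    rw [← neg_sub x y, map_neg] at h1
    rw [hB, hD, LinearMap.sub_apply]
    linarith
  have hB2 : B ≤ 2 * T.M := by
    have h1 := T.le_add x hx y hy 1 zero_le_one le_rfl
    have h2 := T.le_add y hy x hx 1 zero_le_one le_rfl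
    rw [one_smul, add_sub_cancel] at h1 h2
    rw [← neg_sub x y, map_neg] at h1
    rw [hB, hD, LinearMap.sub_apply]
    linarith
  have hBx : (T.DF y - T.DF x) (y - x) = B := by
    rw [hB, hD, ← neg_sub x y, map_neg, LinearMap.sub_apply, LinearMap.sub_apply]
    ring
  -- With `B = 2 M s²` the bound in `key` reads `s * D (u - y) ≤ 3 M s²`. Two such bounds give `6 M
  -- s`, whose square is `18 M B`.
  set s := √(B / (2 * T.M)) with hs
  have hs0 : 0 ≤ s := Real.sqrt_nonneg _
  have hs1 : s ≤ 1 := Real.sqrt_le_one.2 (by rw [div_le_one (by positivity)]; exact hB2)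
  have hs2 : B = 2 * T.M * s ^ 2 := by
    rw [hs, Real.sq_sqrt (by positivity)]
    field_simp
  have hdir : ∀ x ∈ T.C, ∀ y ∈ T.C, (T.DF x - T.DF y) (x - y) = B → ∀ u ∈ T.C,
      (T.DF x - T.DF y) (u - y) ≤ 3 * T.M * s := by
    intro x hx y hy hxy u hu
    rcases hs0.eq_or_lt with h | h
    · have h0 : B = 0 := by rw [hs2, ← h]; ring
      rw [← h, mul_zero, ← neg_nonneg]
      refine nonneg_of_forall_mul_add_sq_mul_nonneg hM fun r hr0 hr1 => ?_
      have := key x hx y hy r hr0.le hr1 u hu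
      rw [hxy, h0] at this
      linarith
    · have := key x hx y hy s hs0 hs1 u hu
      rw [hxy] at this
      refine le_of_mul_le_mul_left (a := s) ?_ h
      nlinarith
  have hle : ∀ u ∈ T.C, ∀ v ∈ T.C, D (u - v) ≤ 6 * T.M * s := by
    intro u hu v hv
    have h1 := hdir x hx y hy rfl u hu
    have h2 := hdir y hy x hx hBx v hv
    have h3 : D (u - v) = (T.DF x - T.DF y) (u - y) + (T.DF y - T.DF x) (v - x) - B := by
      rw [hB, hD]
      simp only [LinearMap.sub_apply, map_sub]
      ring
    linarith
  have h1 := hle u hu v hv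
  have h2 := hle v hv u hu
  rw [← neg_sub u v, map_neg] at h2
  have h3 := sq_le_sq' (by linarith) h1
  calc _ ≤ _ := h3
    _ = 18 * T.M * B := by rw [hs2]; ring

/-- If `q` is not in the closed set `E (conv W)`, it has positive distance from it; there are only
finitely many `W`. -/
theorem exists_feasible_of_norm_le (T : PolytopeProgram Z Y) :
    ∃ δ : ℝ, 0 < δ ∧ ∀ W ⊆ T.V, ∀ z ∈ convexHull ℝ (W : Set Z), ‖T.q - T.E z‖ ≤ δ →
      ∃ z' ∈ convexHull ℝ (W : Set Z), T.E z' = T.q := by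
  have h : ∀ W : Finset Z, ∃ δ : ℝ, 0 < δ ∧ ∀ z ∈ convexHull ℝ (W : Set Z),
      ‖T.q - T.E z‖ ≤ δ → ∃ z' ∈ convexHull ℝ (W : Set Z), T.E z' = T.q := by
    intro W
    by_cases hq : T.q ∈ T.E '' convexHull ℝ (W : Set Z)
    · exact ⟨1, one_pos, fun _ _ _ => hq⟩
    · have hcl : IsClosed (T.E '' convexHull ℝ (W : Set Z)) := by
        rw [LinearMap.image_convexHull]
        exact (W.finite_toSet.image _).isClosed_convexHull ℝ
      obtain ⟨δ, hδ, hb⟩ := Metric.isOpen_iff.1 hcl.isOpen_compl T.q hq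
      refine ⟨δ / 2, by positivity, fun z hz hn => ?_⟩
      refine absurd ⟨z, hz, rfl⟩ (hb (a := T.E z) ?_)
      rw [Metric.mem_ball', dist_eq_norm]
      linarith
  choose δ hδ h using h
  obtain ⟨e, he0, he⟩ := T.V.powerset.exists_pos_forall_le δ hδ
  exact ⟨e, he0, fun W hW z hz hn => h W z hz (hn.trans (he W (Finset.mem_powerset.2 hW)))⟩

end PolytopeProgram

/-! ### The error bound for the dual function of a polytope program. -/

namespace PolytopeProgram

variable {Z Y : Type*} [AddCommGroup Z] [Module ℝ Z] [NormedAddCommGroup Y]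
    [InnerProductSpace ℝ Y] [FiniteDimensional ℝ Y] {T : PolytopeProgram Z Y}

/-- Superlevel sets of the dual function lie within bounded distance of its maximizers. -/
theorem IsDual.exists_norm_sub_le {d : Y → ℝ} (hd : T.IsDual d) (hmax : ∃ y₀, ∀ y, d y ≤ d y₀)
    (η : ℝ) : ∃ R : ℝ, 0 < R ∧ ∀ y, η ≤ d y → ∃ y₁, (∀ y', d y' ≤ d y₁) ∧ ‖y - y₁‖ ≤ R := by
  obtain ⟨y₀, hy₀⟩ := hmax
  -- `η ≤ d y` bounds `⟪y, q - E v⟫` below at every vertex. Hoffman with right-hand side `0` moves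
  -- `y` a bounded distance to some `y'` with all these products nonnegative; adding such a `y'` to
  -- `y₀` cannot decrease `d`.
  obtain ⟨κ, hκ, h⟩ := exists_hoffman_constant (fun v : T.V => -(T.q - T.E v))
  set K : ℝ := ∑ v ∈ T.V, |T.F v + T.ρ / 2 * ‖T.q - T.E v‖ ^ 2| with hK
  have hK0 : 0 ≤ K := Finset.sum_nonneg fun i _ => abs_nonneg _
  refine ⟨κ * (|η| + K) + ‖y₀‖ + 1, by positivity, fun y hy => ?_⟩
  obtain ⟨y', hy', hn⟩ := h 0 (|η| + K) y (by positivity) ⟨0, by simp⟩ fun v => by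
    have h1 := hd.le_augL y (subset_convexHull ℝ _ v.2)
    have h2 : |T.F v + T.ρ / 2 * ‖T.q - T.E v‖ ^ 2| ≤ K :=
      Finset.single_le_sum (f := fun v => |T.F v + T.ρ / 2 * ‖T.q - T.E v‖ ^ 2|)
        (fun i _ => abs_nonneg _) v.2
    have h3 := le_abs_self (T.F v + T.ρ / 2 * ‖T.q - T.E v‖ ^ 2)
    have h4 := neg_abs_le η
    unfold augL at h1
    rw [inner_neg_left, real_inner_comm, Pi.zero_apply]
    linarith
  have hC : ∀ z ∈ T.C, T.E z ∈ {x | ⟪y', x⟫ ≤ ⟪y', T.q⟫} := by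
    have hconv : Convex ℝ (T.E ⁻¹' {x | ⟪y', x⟫ ≤ ⟪y', T.q⟫}) :=
      (convex_halfSpace_le (innerₗ Y y').isLinear ⟪y', T.q⟫).linear_preimage T.E
    refine fun z hz => convexHull_min (fun v hv => ?_) hconv hz
    have := hy' ⟨v, hv⟩
    simp only [inner_neg_left, Pi.zero_apply, inner_sub_left] at this
    simp only [Set.mem_preimage, Set.mem_ofPred_eq]
    rw [real_inner_comm, real_inner_comm T.q]
    linarith
  refine ⟨y₀ + y', fun y'' => (hy₀ y'').trans ?_, ?_⟩
  · obtain ⟨z, hz, e⟩ := hd (y₀ + y')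
    have h1 := T.augL_sub z y₀ (y₀ + y')
    have h2 := hd.le_augL y₀ hz.1
    have h3 := hC z hz.1
    rw [add_sub_cancel_left, inner_sub_right] at h1
    simp only [Set.mem_ofPred_eq] at h3
    linarith
  · calc ‖y - (y₀ + y')‖ = ‖(y - y') - y₀‖ := by congr 1; abel
      _ ≤ ‖y - y'‖ + ‖y₀‖ := norm_sub_le _ _
      _ ≤ _ := by linarith

/-- The error bound for the vertices in `W`: approximate multipliers that make the linearized
Lagrangian minimal on `W` are close to exact ones. -/
theorem exists_multiplier_constants (T : PolytopeProgram Z Y) (c : Z →ₗ[ℝ] ℝ) :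
    ∃ κ ε : ℝ, 0 < κ ∧ 0 < ε ∧ ∀ W ⊆ T.V, ∀ (m : ℝ) (y : Y), 0 ≤ m → m ≤ ε →
      (∀ v ∈ W, ∀ u ∈ T.V, ⟪T.E (u - v), y⟫ ≤ c (u - v) + m) →
      ∃ y', (∀ v ∈ W, ∀ u ∈ T.V, ⟪T.E (u - v), y'⟫ ≤ c (u - v)) ∧ ‖y - y'‖ ≤ κ * m := by
  have h := fun W : Finset Z => exists_local_hoffman_constant
    (fun i : W × T.V => T.E (i.2.1 - i.1.1)) (fun i => c (i.2.1 - i.1.1))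
  choose κ ε hκ hε h using h
  obtain ⟨e, he0, he⟩ := T.V.powerset.exists_pos_forall_le ε hε
  refine ⟨∑ W ∈ T.V.powerset, κ W, e, Finset.sum_pos (fun W _ => hκ W) ⟨∅, by simp⟩, he0, ?_⟩
  intro W hW m y hm0 hm hy
  rw [← Finset.mem_powerset] at hW
  obtain ⟨y', hy', hn⟩ := h W m y hm0 (hm.trans (he W hW)) fun i => hy _ i.1.2 _ i.2.2
  refine ⟨y', fun v hv u hu => hy' (⟨v, hv⟩, ⟨u, hu⟩), hn.trans ?_⟩
  gcongr
  exact Finset.single_le_sum (f := κ) (fun W _ => (hκ W).le) hW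

/-- A multiplier that makes the Lagrangian, linearized at a solution `z₀`, minimal on a face
containing a feasible point is a maximizer of the dual function. -/
theorem IsDual.forall_le_of_face {d : Y → ℝ} (hd : T.IsDual d) {y₀ : Y} {z₀ : Z}
    (hz₀ : T.IsMinimizer y₀ z₀) (hE : T.E z₀ = T.q) {W : Finset Z} (hW : W ⊆ T.V) {z' : Z}
    (hz' : z' ∈ convexHull ℝ (W : Set Z)) (hE' : T.E z' = T.q) {y' : Y}
    (hy' : ∀ v ∈ W, ∀ u ∈ T.V, ⟪T.E (u - v), y'⟫ ≤ T.DF z₀ (u - v)) :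
    ∀ y, d y ≤ d y' := by
  set l : Z →ₗ[ℝ] ℝ := T.DF z₀ - (innerₗ Y y').comp T.E with hl
  have hlap : ∀ x, l x = T.DF z₀ x - ⟪y', T.E x⟫ := fun x => rfl
  have h1 : ∀ v ∈ W, ∀ w ∈ T.C, l v ≤ l w := by
    intro v hv w hw
    have hconv : Convex ℝ {w | l v ≤ l w} := convex_halfSpace_ge l.isLinear _
    refine convexHull_min (fun u hu => ?_) hconv hw
    have := hy' v hv u hu
    rw [real_inner_comm, map_sub, map_sub, inner_sub_right] at this
    simp only [Set.mem_ofPred_eq, hlap]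
    linarith
  have h2 : ∀ w ∈ T.C, l z' ≤ l w := by
    intro w hw
    have hconv : Convex ℝ {v | l v ≤ l w} := convex_halfSpace_le l.isLinear _
    exact convexHull_min (fun v hv => h1 v hv w hw) hconv hz'
  -- Both `z₀` and `z'` are feasible, so optimality of `z₀` compares `DF z₀` there without the
  -- multiplier. Hence `z₀` also minimizes `l`.
  have h3 := hz₀.inner_le (convexHull_mono (by exact_mod_cast hW) hz' : z' ∈ T.C)
  have h4 : l z₀ = l z' := by
    refine le_antisymm ?_ (h2 z₀ hz₀.1)
    rw [map_sub, hE, hE', sub_self, inner_zero_right, map_sub] at h3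
    rw [hlap, hlap, hE, hE']
    linarith
  have h5 : T.IsMinimizer y' z₀ := by
    refine ⟨hz₀.1, fun w hw => ?_⟩
    have hρ := T.ρ_pos
    refine le_trans ?_ (augL_add_le hz₀.1 hw ?_)
    · have : 0 ≤ T.ρ / 2 * ‖T.E (w - z₀)‖ ^ 2 := by positivity
      linarith
    · have := h2 w hw
      rw [← h4, hlap, hlap] at this
      rw [hE, sub_self, smul_zero, add_zero, map_sub, map_sub, inner_sub_right, hE]
      rw [hE] at this
      linarith
  exact (hd.forall_le_iff h5).2 hE

/-- The dual function of a smooth convex program over a polytope satisfies a local error bound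
on each of its superlevel sets. -/
theorem IsDual.exists_error_bound {d : Y → ℝ} (hd : T.IsDual d) (hmax : ∃ y₀, ∀ y, d y ≤ d y₀)
    (η : ℝ) : ∃ δ τ : ℝ, 0 < δ ∧ 0 < τ ∧ ∀ y, η ≤ d y → ‖gradient d y‖ ≤ δ →
      Metric.infDist y {y | ∀ y', d y' ≤ d y} ≤ τ * ‖gradient d y‖ := by
  classical
  obtain ⟨R, hR0, hR⟩ := hd.exists_norm_sub_le hmax η
  obtain ⟨y₀, hy₀⟩ := hmax
  obtain ⟨z₀, hz₀, -⟩ := hd y₀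
  have hE : T.E z₀ = T.q := (hd.forall_le_iff hz₀).1 hy₀
  obtain ⟨κ, ε, hκ, hε, hmul⟩ := T.exists_multiplier_constants (T.DF z₀)
  obtain ⟨δ, hδ, hfeas⟩ := T.exists_feasible_of_norm_le
  have hρ := T.ρ_pos
  have hM := T.M_pos
  set S : Set Y := {y | ∀ y', d y' ≤ d y} with hS
  have hdc : Continuous d := continuous_iff_continuousAt.2 fun y => by
    obtain ⟨z, hz, -⟩ := hd y
    exact (hd.hasGradientAt hz).hasFDerivAt.continuousAt
  have hSc : IsClosed S := by
    simp only [hS, Set.ofPred_forall]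
    exact isClosed_iInter fun y' => isClosed_le continuous_const hdc
  -- The first threshold makes the face of `W` meet `E z = q`; the second forces `m ≤ ε`, as the
  -- perturbed Hoffman bound requires.
  refine ⟨min δ (ε ^ 2 / (18 * T.M * R)), 2 * T.ρ + 18 * κ ^ 2 * T.M, by positivity,
    by positivity, fun y hy hr => ?_⟩
  obtain ⟨z, hz, -⟩ := hd y
  rw [(hd.hasGradientAt hz).gradient] at hr ⊢
  set r := T.q - T.E z with hrdef
  obtain ⟨y₁, hy₁S, hdist⟩ := hSc.exists_infDist_eq_dist ⟨y₀, hy₀⟩ y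
  have hyR : ‖y - y₁‖ ≤ R := by
    obtain ⟨y₂, hy₂, hn⟩ := hR y hy
    rw [← dist_eq_norm, ← hdist]
    exact (Metric.infDist_le_dist_of_mem (s := S) hy₂).trans (by rwa [dist_eq_norm])
  have hz₁ := hd.isMinimizer_of_forall_le hz₀ hE hy₁S
  set D := T.DF z - T.DF z₀ with hD
  -- monotonicity
  have hB : D (z - z₀) ≤ ‖y - y₁‖ * ‖r‖ := by
    have h1 := hz.inner_le hz₀.1
    have h2 := hz₁.inner_le hz.1
    rw [← hrdef] at h1
    rw [hE, sub_self, smul_zero, add_zero] at h2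
    have e1 : T.E (z₀ - z) = r := by rw [map_sub, hE]
    have e2 : T.E (z - z₀) = -r := by rw [map_sub, hE, hrdef, neg_sub]
    rw [e1, inner_add_left, real_inner_smul_left, real_inner_self_eq_norm_sq, ← neg_sub z z₀,
      map_neg] at h1
    rw [e2, inner_neg_right] at h2
    have h3 : -⟪y - y₁, r⟫ ≤ ‖y - y₁‖ * ‖r‖ :=
      (neg_le_abs _).trans (abs_real_inner_le_norm _ _)
    rw [inner_sub_left] at h3
    have h4 : 0 ≤ T.ρ * ‖r‖ ^ 2 := by positivity
    rw [hD, LinearMap.sub_apply]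
    linarith
  set m := √(18 * T.M * (‖y - y₁‖ * ‖r‖)) with hm
  have hm0 : 0 ≤ m := Real.sqrt_nonneg _
  have hm2 : m ^ 2 = 18 * T.M * (‖y - y₁‖ * ‖r‖) := Real.sq_sqrt (by positivity)
  have hDm : ∀ u ∈ T.C, ∀ v ∈ T.C, D (u - v) ≤ m := by
    intro u hu v hv
    refine Real.le_sqrt_of_sq_le ((T.sq_sub_le hz.1 hz₀.1 hu hv).trans ?_)
    gcongr
  have hmε : m ≤ ε := by
    refine abs_le_of_sq_le_sq' ?_ hε.le |>.2
    have h1 : ‖r‖ * (18 * T.M * R) ≤ ε ^ 2 :=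
      (le_div_iff₀ (by positivity)).1 (hr.trans (min_le_right _ _))
    rw [hm2]
    calc 18 * T.M * (‖y - y₁‖ * ‖r‖) ≤ 18 * T.M * (R * ‖r‖) := by gcongr
      _ ≤ ε ^ 2 := by linarith
  -- The multiplier shifted by the penalty term: with it `z` minimizes the linearized Lagrangian,
  -- and `W` below consists of the vertices of the minimizing face.
  set yt := y + T.ρ • r with hyt
  set l : Z →ₗ[ℝ] ℝ := T.DF z - (innerₗ Y yt).comp T.E with hl
  have hlap : ∀ x, l x = T.DF z x - ⟪yt, T.E x⟫ := fun x => rfl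
  have hlz : ∀ w ∈ T.C, l z ≤ l w := by
    intro w hw
    have := hz.inner_le hw
    rw [← hrdef, ← hyt, map_sub, map_sub, inner_sub_right] at this
    rw [hlap, hlap]
    linarith
  set W := T.V.filter fun v => l v = l z with hW
  have hWV : W ⊆ T.V := Finset.filter_subset _ _
  have hzW : z ∈ convexHull ℝ (W : Set Z) :=
    mem_convexHull_filter_of_le l hz.1 (fun v hv => hlz v (subset_convexHull ℝ _ hv)) W
      fun v hv h => Finset.mem_filter.2 ⟨hv, h⟩
  obtain ⟨z', hz'W, hz'E⟩ := hfeas W hWV z hzW (hr.trans (min_le_left _ _))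
  obtain ⟨y', hy', hn⟩ := hmul W hWV m yt hm0 hmε fun v hv u hu => by
    have huC : u ∈ T.C := subset_convexHull ℝ _ hu
    have hvC : v ∈ T.C := subset_convexHull ℝ _ (hWV hv)
    have h1 := hlz u huC
    rw [← (Finset.mem_filter.1 hv).2, hlap, hlap] at h1
    have h2 := hDm u huC v hvC
    rw [hD, LinearMap.sub_apply, map_sub] at h2
    rw [real_inner_comm, map_sub, inner_sub_right]
    linarith
  have hy'S : y' ∈ S := hd.forall_le_of_face hz₀ hE hWV hz'W hz'E hy'
  have h1 : ‖y - y₁‖ ≤ κ * m + T.ρ * ‖r‖ := by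
    rw [← dist_eq_norm, ← hdist]
    refine (Metric.infDist_le_dist_of_mem hy'S).trans ?_
    calc dist y y' = ‖(yt - y') - T.ρ • r‖ := by rw [dist_eq_norm, hyt]; congr 1; abel
      _ ≤ ‖yt - y'‖ + ‖T.ρ • r‖ := norm_sub_le _ _
      _ ≤ κ * m + T.ρ * ‖r‖ := by
        rw [norm_smul, Real.norm_eq_abs, abs_of_pos hρ]
        gcongr
  rw [hdist, dist_eq_norm]
  rcases (norm_nonneg (y - y₁)).eq_or_lt with h0 | h0
  · rw [← h0]; positivity
  -- Arithmetic–geometric mean: `κ² m² = 4 * (‖y - y₁‖ / 2) * (9 κ² M ‖r‖)`. Half the distance is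
  -- then absorbed.
  have h2 : κ * m ≤ ‖y - y₁‖ / 2 + 9 * κ ^ 2 * T.M * ‖r‖ := by
    refine abs_le_of_sq_le_sq' ?_ (by positivity) |>.2
    rw [mul_pow, hm2]
    nlinarith [sq_nonneg (‖y - y₁‖ / 2 - 9 * κ ^ 2 * T.M * ‖r‖)]
  linarith

end PolytopeProgram

/-! ### A two-variable Euclidean norm term excludes polyhedral level sets. -/

/-- Equality case of the triangle inequality for `(x₁, x₂, √C)` and `(y₁, y₂, √C)`: they point in
the same direction, hence coincide when `C > 0`. -/
theorem sqrt_midpoint_eq {x₁ x₂ y₁ y₂ C : ℝ} (hC : 0 ≤ C)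
    (h : (√(x₁ ^ 2 + x₂ ^ 2 + C) + √(y₁ ^ 2 + y₂ ^ 2 + C)) / 2 ≤
      √(((x₁ + y₁) / 2) ^ 2 + ((x₂ + y₂) / 2) ^ 2 + C)) :
    0 ≤ x₁ * y₁ + x₂ * y₂ + C ∧ x₁ * y₂ = x₂ * y₁ ∧
      C * ((x₁ - y₁) ^ 2 + (x₂ - y₂) ^ 2) = 0 := by
  set a := √(x₁ ^ 2 + x₂ ^ 2 + C)
  set b := √(y₁ ^ 2 + y₂ ^ 2 + C)
  set c := √(((x₁ + y₁) / 2) ^ 2 + ((x₂ + y₂) / 2) ^ 2 + C)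
  have ha : a ^ 2 = x₁ ^ 2 + x₂ ^ 2 + C := Real.sq_sqrt (by positivity)
  have hb : b ^ 2 = y₁ ^ 2 + y₂ ^ 2 + C := Real.sq_sqrt (by positivity)
  have hc : c ^ 2 = ((x₁ + y₁) / 2) ^ 2 + ((x₂ + y₂) / 2) ^ 2 + C := Real.sq_sqrt (by positivity)
  have ha0 : 0 ≤ a := Real.sqrt_nonneg _
  have hb0 : 0 ≤ b := Real.sqrt_nonneg _
  have h1 : ((a + b) / 2) ^ 2 ≤ c ^ 2 := pow_le_pow_left₀ (by positivity) h 2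
  have h2 : a * b ≤ x₁ * y₁ + x₂ * y₂ + C := by nlinarith
  have h3 : 0 ≤ a * b := by positivity
  have h4 : (a * b) ^ 2 ≤ (x₁ * y₁ + x₂ * y₂ + C) ^ 2 := pow_le_pow_left₀ h3 h2 2
  rw [mul_pow, ha, hb] at h4
  have h5 : 0 ≤ C * ((x₁ - y₁) ^ 2 + (x₂ - y₂) ^ 2) := by positivity
  have h6 : (x₁ * y₂ - x₂ * y₁) ^ 2 + C * ((x₁ - y₁) ^ 2 + (x₂ - y₂) ^ 2) ≤ 0 := by linarith
  refine ⟨h3.trans h2, ?_, by nlinarith [sq_nonneg (x₁ * y₂ - x₂ * y₁)]⟩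
  have : (x₁ * y₂ - x₂ * y₁) ^ 2 = 0 :=
    le_antisymm (by linarith) (sq_nonneg _)
  linarith [pow_eq_zero_iff (two_ne_zero) |>.1 this]

/-- The sum of a piecewise affine convex function of two variables and a function containing a
Euclidean norm of both variables has a level set that is not polyhedral. -/
theorem false_of_isPolyhedral_level_add_sqrt {J : Type*} [Finite J] {U : Set (ℝ × ℝ)}
    (hU : IsOpen U) (hne : U.Nonempty) {φ H : ℝ × ℝ → ℝ} {lam w C : ℝ} (hlam : 0 ≤ lam)
    (hw : 0 < w) (hC : 0 ≤ C) (l : J → ℝ × ℝ →ₗ[ℝ] ℝ) (γ : J → ℝ) (hφ : ConvexOn ℝ U φ)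
    (hpiece : ∀ z ∈ U, ∃ j, φ z = l j z + γ j)
    (hH : ∀ z ∈ U, H z = φ z + (lam * (|z.1| + |z.2|) + w * √(z.1 ^ 2 + z.2 ^ 2 + C)))
    (hHconv : ConvexOn ℝ U H) (hHcont : ContinuousOn H U)
    (hlev : ∀ ξ : ℝ, ∃ S, IsPolyhedral S ∧ ∀ z ∈ U, (z ∈ S ↔ H z ≤ ξ)) : False := by
  have hHat : ∀ z ∈ U, ContinuousAt H z := fun z hz => hHcont.continuousAt (hU.mem_nhds hz)
  have hmidU : ∀ x ∈ U, ∀ y ∈ U, (1 / 2 : ℝ) • x + (1 / 2 : ℝ) • y ∈ U := fun x hx y hy =>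
    hHconv.1 hx hy (by norm_num) (by norm_num) (by norm_num)
  -- `φ` and the absolute values are convex, so a failure of strict convexity of `H` at the midpoint
  -- must already occur in the square root.
  have hpar : ∀ x ∈ U, ∀ y ∈ U, (H x + H y) / 2 ≤ H ((1 / 2 : ℝ) • x + (1 / 2 : ℝ) • y) →
      0 ≤ x.1 * y.1 + x.2 * y.2 + C ∧ x.1 * y.2 = x.2 * y.1 ∧
        C * ((x.1 - y.1) ^ 2 + (x.2 - y.2) ^ 2) = 0 := by
    intro x hx y hy h
    apply sqrt_midpoint_eq hC
    have h1 := hφ.2 hx hy (show (0 : ℝ) ≤ 1 / 2 by norm_num)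
      (show (0 : ℝ) ≤ 1 / 2 by norm_num) (by norm_num)
    rw [hH x hx, hH y hy, hH _ (hmidU x hx y hy)] at h
    simp only [smul_eq_mul, Prod.fst_add, Prod.snd_add, Prod.smul_fst, Prod.smul_snd] at h h1
    have e1 : 1 / 2 * x.1 + 1 / 2 * y.1 = (x.1 + y.1) / 2 := by ring
    have e2 : 1 / 2 * x.2 + 1 / 2 * y.2 = (x.2 + y.2) / 2 := by ring
    rw [e1, e2, abs_div, abs_div, abs_two] at h
    have h2 := mul_le_mul_of_nonneg_left (abs_add_le x.1 y.1) hlam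
    have h3 := mul_le_mul_of_nonneg_left (abs_add_le x.2 y.2) hlam
    refine le_of_mul_le_mul_left (a := w) ?_ hw
    linarith
  -- `H` is not constant
  obtain ⟨a, ha, b, hb, hab⟩ : ∃ a ∈ U, ∃ b ∈ U, H a < H b := by
    by_contra! hcon
    have hall : ∀ x ∈ U, ∀ y ∈ U, x.1 * y.2 = x.2 * y.1 := fun x hx y hy => by
      refine (hpar x hx y hy ?_).2.1
      have h1 := hcon _ (hmidU x hx y hy) x hx
      have h2 := hcon _ (hmidU x hx y hy) y hy
      linarith
    obtain ⟨z, hz⟩ := hne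
    have hev : ∀ v : ℝ × ℝ, ∀ᶠ e : ℝ in nhds 0, z + e • v ∈ U := fun v => by
      have hc : Continuous fun e : ℝ => z + e • v := by fun_prop
      exact hc.tendsto 0 |>.eventually (by simpa using hU.mem_nhds hz)
    have := ((hev (1, 0)).and ((hev (0, 1)).and (hev (1, 1)))).filter_mono
      (nhdsWithin_le_nhds (s := Set.Ioi 0))
    obtain ⟨e, ⟨h1, h2, h3⟩, he : 0 < e⟩ := (this.and self_mem_nhdsWithin).exists
    have k1 := hall _ hz _ h1
    have k2 := hall _ h2 _ h3
    simp at k1 k2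
    have k3 : e * z.2 = 0 := by linarith
    have k4 : z.2 = 0 := by simpa [he.ne'] using k3
    rw [k4] at k2
    nlinarith [mul_pos he he]
  -- Avoiding the finitely many constants `γ` is what the final contradiction needs.
  obtain ⟨ξ, hξ, hξγ⟩ : (Set.Ioo (H a) (H b) \ Set.range γ).Nonempty :=
    ((Set.Ioo_infinite hab).sdiff (Set.finite_range γ)).nonempty
  obtain ⟨S, ⟨j, A, c, rfl⟩, hS⟩ := hlev ξ
  -- Orthogonal to `b - a`, so crossing points on the segments shifted by different `τ • n` are
  -- distinct.
  set n : ℝ × ℝ := (-(b - a).2, (b - a).1) with hn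
  have hab' : b - a ≠ 0 := by
    intro h
    rw [sub_eq_zero.1 h] at hab
    exact lt_irrefl _ hab
  have hnpos : 0 < n.1 ^ 2 + n.2 ^ 2 := by
    rcases eq_or_ne (b - a).1 0 with h | h
    · have h' : (b - a).2 ≠ 0 := fun h' => hab' (Prod.ext h h')
      have : 0 < (b - a).2 ^ 2 := by positivity
      simp only [hn, neg_sq]
      positivity
    · have : 0 < (b - a).1 ^ 2 := by positivity
      simp only [hn, neg_sq]
      positivity
  have hshift : ∀ x ∈ U, ∀ v : ℝ × ℝ, ∀ᶠ τ : ℝ in nhds 0, x + τ • v ∈ U := fun x hx v => by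
    have hc : Continuous fun e : ℝ => x + e • v := by fun_prop
    exact hc.tendsto 0 |>.eventually (by simpa using hU.mem_nhds hx)
  have hHshift : ∀ x ∈ U, ∀ v : ℝ × ℝ,
      Filter.Tendsto (fun τ : ℝ => H (x + τ • v)) (nhds 0) (nhds (H x)) := fun x hx v => by
    have hc : Continuous fun e : ℝ => x + e • v := by fun_prop
    have h1 : Filter.Tendsto (fun e : ℝ => x + e • v) (nhds 0) (nhds x) := by
      simpa using hc.tendsto 0
    exact (hHat x hx).tendsto.comp h1
  set Ts : Set ℝ := {τ | a + τ • n ∈ U ∧ b + τ • n ∈ U ∧ H (a + τ • n) < ξ ∧ ξ < H (b + τ • n)}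
    with hTs
  have hTsinf : Ts.Infinite := by
    refine infinite_of_mem_nhds 0 ?_
    filter_upwards [hshift a ha n, hshift b hb n,
      (hHshift a ha n).eventually_lt_const hξ.1, (hHshift b hb n).eventually_const_lt hξ.2]
      with τ h1 h2 h3 h4 using ⟨h1, h2, h3, h4⟩
  have hex : ∀ τ : Ts, ∃ (z : ℝ × ℝ) (lab : Fin j × J), z ∈ U ∧ H z = ξ ∧
      φ z = l lab.2 z + γ lab.2 ∧ A lab.1 z = c lab.1 ∧ A lab.1 (b - a) < 0 ∧
      n.1 * (z.1 - a.1) + n.2 * (z.2 - a.2) = τ * (n.1 ^ 2 + n.2 ^ 2) := by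
    rintro ⟨τ, hτa, hτb, hlt, hgt⟩
    set a' := a + τ • n with ha'
    have hb' : b + τ • n = a' + (b - a) := by rw [ha']; abel
    have hseg : ∀ θ ∈ Set.Icc (0 : ℝ) 1, a' + θ • (b - a) ∈ U := fun θ hθ => by
      have := hHconv.1.add_smul_sub_mem hτa hτb hθ
      rwa [hb', add_sub_cancel_left] at this
    have hcont : ContinuousOn (fun θ : ℝ => H (a' + θ • (b - a))) (Set.Icc 0 1) :=
      hHcont.comp (by fun_prop) hseg
    obtain ⟨θ, hθ, hθξ⟩ := intermediate_value_Icc zero_le_one hcont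
      (show ξ ∈ Set.Icc _ _ by
        simp only [zero_smul, add_zero, one_smul, ← hb']
        exact ⟨hlt.le, hgt.le⟩)
    simp only at hθξ
    set z := a' + θ • (b - a) with hz
    have hzU : z ∈ U := hseg θ hθ
    have hθ1 : θ < 1 := by
      refine lt_of_le_of_ne hθ.2 ?_
      rintro rfl
      rw [hz, one_smul, ← hb'] at hθξ
      exact hgt.ne' hθξ
    obtain ⟨k, hk⟩ := hpiece z hzU
    -- Otherwise the level set continues a little beyond `z` in direction `b - a`. Then `z` lies
    -- between `a'`, where `H < ξ`, and a point with `H ≤ ξ`, so convexity gives `H z < ξ`.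
    have hact : ∃ i, A i z = c i ∧ A i (b - a) < 0 := by
      by_contra! hcon
      have hzS : ∀ i, c i ≤ A i z := (hS z hzU).2 hθξ.le
      have hev : ∀ᶠ s : ℝ in nhdsWithin 0 (Set.Ioi 0), ∀ i, c i ≤ A i (z + s • (b - a)) := by
        refine Filter.eventually_all.2 fun i => ?_
        by_cases hi : A i z = c i
        · filter_upwards [self_mem_nhdsWithin] with s hs
          rw [map_add, map_smul, smul_eq_mul, hi]
          have := mul_nonneg (le_of_lt hs) (hcon i hi)
          linarith
        · have hlt : c i < A i z + 0 * A i (b - a) := by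
            simpa using lt_of_le_of_ne (hzS i) (Ne.symm hi)
          have hc : Continuous fun s : ℝ => A i z + s * A i (b - a) := by fun_prop
          filter_upwards [((hc.tendsto 0).eventually_const_lt hlt).filter_mono
            nhdsWithin_le_nhds] with s hs
          rw [map_add, map_smul, smul_eq_mul]
          exact hs.le
      obtain ⟨s, ⟨hs, hsU⟩, hs0 : 0 < s⟩ := ((hev.and ((hshift z hzU (b - a)).filter_mono
        nhdsWithin_le_nhds)).and self_mem_nhdsWithin).exists
      have h1 := (hS _ hsU).1 hs
      have hpos : 0 < θ + s := by linarith [hθ.1]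
      have h2 := hHconv.2 hτa hsU (show 0 ≤ s / (θ + s) by positivity)
        (div_nonneg hθ.1 hpos.le) (by field_simp; ring)
      have e : (s / (θ + s)) • a' + (θ / (θ + s)) • (z + s • (b - a)) = z := by
        have e1 : s / (θ + s) = 1 - θ / (θ + s) := by field_simp; ring
        have e2 : θ / (θ + s) * (θ + s) = θ := by field_simp
        rw [hz]
        calc _ = a' + (θ / (θ + s) * (θ + s)) • (b - a) := by rw [e1]; module
          _ = _ := by rw [e2]
      rw [e, hθξ, smul_eq_mul, smul_eq_mul] at h2
      have h3 : s / (θ + s) * H a' < s / (θ + s) * ξ := by gcongr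
      have h4 : θ / (θ + s) * H (z + s • (b - a)) ≤ θ / (θ + s) * ξ :=
        mul_le_mul_of_nonneg_left h1 (div_nonneg hθ.1 hpos.le)
      have h5 : s / (θ + s) * ξ + θ / (θ + s) * ξ = ξ := by field_simp; ring
      linarith
    obtain ⟨i, hi, hi'⟩ := hact
    refine ⟨z, (i, k), hzU, hθξ, hk, hi, hi', ?_⟩
    simp only [hz, ha', hn, Prod.fst_add, Prod.snd_add, Prod.smul_fst, Prod.smul_snd, smul_eq_mul,
      Prod.fst_sub, Prod.snd_sub]
    ring
  choose z lab hzU hzξ hzφ hzA hzneg hzn using hex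
  have := hTsinf.to_subtype
  -- Infinitely many shifts, finitely many labels: two crossing points share a facet of the level
  -- set and an affine piece of `φ`.
  obtain ⟨τ, τ', hne', hlab⟩ := Finite.exists_ne_map_eq_of_infinite lab
  have hxy : z τ ≠ z τ' := by
    intro h
    have h1 := hzn τ
    rw [h, hzn τ'] at h1
    exact hne' (Subtype.ext (mul_right_cancel₀ hnpos.ne' h1).symm)
  rcases hk : lab τ with ⟨i, k⟩
  have hφx := hzφ τ
  have hφy := hzφ τ'
  have hAx := hzA τ
  have hAy := hzA τ'
  have hneg := hzneg τ
  rw [← hlab] at hφy hAy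
  rw [hk] at hφx hφy hAx hAy hneg
  simp only at hφx hφy hAx hAy hneg
  have hxU := hzU τ
  have hyU := hzU τ'
  have hxξ := hzξ τ
  have hyξ := hzξ τ'
  generalize z τ = x at *
  generalize z τ' = y at *
  have hmid := hmidU x hxU y hyU
  -- The midpoint lies on the shared facet, and any step along `b - a` leaves the level set; `H < ξ`
  -- there would allow such a step by continuity.
  have hmidξ : ξ ≤ H ((1 / 2 : ℝ) • x + (1 / 2 : ℝ) • y) := by
    by_contra! hlt
    obtain ⟨s, ⟨hs1, hs2⟩, hs0 : 0 < s⟩ := (((hshift _ hmid (b - a)).and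
      ((hHshift _ hmid (b - a)).eventually_lt_const hlt)).filter_mono
        (nhdsWithin_le_nhds (s := Set.Ioi 0)) |>.and self_mem_nhdsWithin).exists
    have h1 := (hS _ hs1).2 hs2.le i
    simp only [map_add, map_smul, smul_eq_mul, hAx, hAy] at h1
    nlinarith
  obtain ⟨h0, hcr, hCz⟩ := hpar x hxU y hyU (by rw [hxξ, hyξ]; linarith)
  have hC0 : C = 0 := by
    refine (mul_eq_zero.1 hCz).resolve_right fun h => hxy ?_
    have h1 : (x.1 - y.1) ^ 2 = 0 := by nlinarith [sq_nonneg (x.1 - y.1), sq_nonneg (x.2 - y.2)]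
    have h2 : (x.2 - y.2) ^ 2 = 0 := by nlinarith [sq_nonneg (x.1 - y.1), sq_nonneg (x.2 - y.2)]
    exact Prod.ext (sub_eq_zero.1 (by simpa using h1)) (sub_eq_zero.1 (by simpa using h2))
  rw [hH x hxU, hφx, hC0, add_zero] at hxξ
  rw [hH y hyU, hφy, hC0, add_zero] at hyξ
  rw [hC0, add_zero] at h0
  apply hξγ
  refine ⟨k, ?_⟩
  rcases eq_or_ne x 0 with rfl | hx0
  · simpa using hxξ
  have hxn : 0 < x.1 ^ 2 + x.2 ^ 2 := by
    rcases eq_or_ne x.1 0 with h | h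
    · have h' : x.2 ≠ 0 := fun h' => hx0 (Prod.ext h h')
      positivity
    · positivity
  set t := (x.1 * y.1 + x.2 * y.2) / (x.1 ^ 2 + x.2 ^ 2) with ht
  have ht0 : 0 ≤ t := by positivity
  have hyx : y = t • x := by
    refine Prod.ext ?_ ?_
    · rw [Prod.smul_fst, smul_eq_mul, ht, div_mul_eq_mul_div, eq_div_iff hxn.ne']
      linear_combination (-x.2) * hcr
    · rw [Prod.smul_snd, smul_eq_mul, ht, div_mul_eq_mul_div, eq_div_iff hxn.ne']
      linear_combination x.1 * hcr
  have ht1 : 1 - t ≠ 0 := by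
    intro h
    apply hxy
    rw [hyx, ← sub_eq_zero.1 h, one_smul]
  rw [hyx, map_smul, Prod.smul_fst, Prod.smul_snd] at hyξ
  simp only [smul_eq_mul, abs_mul, abs_of_nonneg ht0] at hyξ
  have e : √((t * x.1) ^ 2 + (t * x.2) ^ 2) = t * √(x.1 ^ 2 + x.2 ^ 2) := by
    rw [← Real.sqrt_sq ht0, ← Real.sqrt_mul (sq_nonneg t), Real.sqrt_sq ht0]
    congr 1; ring
  rw [e] at hyξ
  -- On the ray through `x` the function `H - γ k` is positively homogeneous at `x` and `y = t • x`,
  -- so `ξ - γ k = t * (ξ - γ k)` with `t ≠ 1`.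
  refine mul_left_cancel₀ ht1 ?_
  linear_combination hyξ - t * hxξ

/-! ### Calculus of polyhedral sets and epigraphs. -/

section Polyhedral

variable {V W : Type*} [AddCommGroup V] [Module ℝ V] [AddCommGroup W] [Module ℝ W]

theorem isPolyhedral_of_finite {ι : Type*} [Finite ι] (a : ι → V →ₗ[ℝ] ℝ) (c : ι → ℝ) :
    IsPolyhedral {x | ∀ i, c i ≤ a i x} := by
  obtain ⟨j, ⟨e⟩⟩ := Finite.exists_equiv_fin ι
  refine ⟨j, fun i => a (e.symm i), fun i => c (e.symm i), Set.ext fun x => ?_⟩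
  exact ⟨fun h i => h _, fun h i => by simpa using h (e i)⟩

theorem IsPolyhedral.inter {S T : Set V} (hS : IsPolyhedral S) (hT : IsPolyhedral T) :
    IsPolyhedral (S ∩ T) := by
  obtain ⟨j, a, c, rfl⟩ := hS
  obtain ⟨j', a', c', rfl⟩ := hT
  convert isPolyhedral_of_finite (Sum.elim a a') (Sum.elim c c') using 1
  ext x
  simp

theorem IsPolyhedral.preimage_add {S : Set W} (hS : IsPolyhedral S) (L : V →ₗ[ℝ] W) (b : W) :
    IsPolyhedral {x | b + L x ∈ S} := by
  obtain ⟨j, a, c, rfl⟩ := hS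
  refine ⟨j, fun i => (a i).comp L, fun i => c i - a i b, Set.ext fun x => ?_⟩
  simp only [Set.mem_ofPred_eq, map_add, LinearMap.comp_apply, sub_le_iff_le_add']

theorem IsPolyhedral.preimage {S : Set W} (hS : IsPolyhedral S) (L : V →ₗ[ℝ] W) :
    IsPolyhedral (L ⁻¹' S) := by
  have h := hS.preimage_add L 0
  simp only [zero_add] at h
  exact h

theorem IsPolyhedral.convex {S : Set V} (hS : IsPolyhedral S) : Convex ℝ S := by
  obtain ⟨j, a, c, rfl⟩ := hS
  simp only [Set.ofPred_forall]
  exact convex_iInter fun i => convex_halfSpace_ge (a i).isLinear _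

theorem IsPolyhedral.isClosed [TopologicalSpace V] [IsTopologicalAddGroup V] [ContinuousSMul ℝ V]
    [T2Space V] [FiniteDimensional ℝ V] {S : Set V} (hS : IsPolyhedral S) : IsClosed S := by
  obtain ⟨j, a, c, rfl⟩ := hS
  simp only [Set.ofPred_forall]
  exact isClosed_iInter fun i => isClosed_le continuous_const (a i).continuous_of_finiteDimensional

/-- Some constraint defining the epigraph is active, and not vertical, at each point of the
graph. -/
theorem ExtFun.exists_active {φ : ExtFun V} {j : ℕ} {a : Fin j → V × ℝ →ₗ[ℝ] ℝ} {c : Fin j → ℝ}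
    (h : φ.epigraph = {z | ∀ i, c i ≤ a i z}) {x : V} (hx : x ∈ φ.dom) :
    ∃ i, 0 < a i (0, 1) ∧ φ.val x = (c i - a i (x, 0)) / a i (0, 1) := by
  have hsplit : ∀ i t, a i (x, t) = a i (x, 0) + t * a i (0, 1) := fun i t => by
    rw [← smul_eq_mul, ← map_smul, ← map_add]
    simp
  have hmem : ∀ t, (x, t) ∈ φ.epigraph ↔ φ.val x ≤ t := fun t =>
    ⟨fun h => h.2, fun h => ⟨hx, h⟩⟩
  have h0 : ∀ i, c i ≤ a i (x, φ.val x) := by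
    have := (hmem _).2 le_rfl
    rw [h] at this
    exact this
  -- If every constraint with positive vertical coefficient were slack, the point of the graph could
  -- be lowered inside the epigraph.
  by_contra! hcon
  have hev : ∀ᶠ s : ℝ in nhdsWithin 0 (Set.Ioi 0), ∀ i, c i ≤ a i (x, φ.val x - s) := by
    refine Filter.eventually_all.2 fun i => ?_
    have h0i := h0 i
    rw [hsplit] at h0i
    rcases le_or_gt (a i (0, 1)) 0 with hi | hi
    · filter_upwards [self_mem_nhdsWithin] with s hs
      have hs : 0 < s := hs
      rw [hsplit]
      nlinarith
    · have hlt : c i < a i (x, 0) + (φ.val x - 0) * a i (0, 1) := by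
        rw [sub_zero]
        refine lt_of_le_of_ne h0i fun he => hcon i hi ?_
        rw [eq_div_iff hi.ne', he]
        ring
      have hc : Continuous fun s : ℝ => a i (x, 0) + (φ.val x - s) * a i (0, 1) := by fun_prop
      filter_upwards [((hc.tendsto 0).eventually_const_lt hlt).filter_mono
        nhdsWithin_le_nhds] with s hs
      rw [hsplit]
      exact hs.le
  obtain ⟨s, hs, hs0 : 0 < s⟩ := (hev.and self_mem_nhdsWithin).exists
  have : (x, φ.val x - s) ∈ φ.epigraph := by rw [h]; exact hs
  linarith [(hmem _).1 this]

theorem ExtFun.convexOn_of_isPolyhedral {φ : ExtFun V} (h : IsPolyhedral φ.epigraph) :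
    ConvexOn ℝ φ.dom φ.val :=
  convexOn_iff_convex_epigraph.2 h.convex

/-- Adding a weighted absolute value of a linear functional preserves polyhedrality. -/
theorem isPolyhedral_epigraph_add_abs {D : Set V} {φ : V → ℝ}
    (h : IsPolyhedral (ExtFun.epigraph ⟨D, φ⟩)) (l : V →ₗ[ℝ] ℝ) {κ : ℝ} (hκ : 0 ≤ κ) :
    IsPolyhedral (ExtFun.epigraph ⟨D, fun x => φ x + κ * |l x|⟩) := by
  set f : V × ℝ →ₗ[ℝ] ℝ := κ • l.comp (LinearMap.fst ℝ V ℝ)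
  have h1 := h.preimage ((LinearMap.fst ℝ V ℝ).prod (LinearMap.snd ℝ V ℝ - f))
  have h2 := h.preimage ((LinearMap.fst ℝ V ℝ).prod (LinearMap.snd ℝ V ℝ + f))
  convert h1.inter h2 using 1
  ext ⟨x, t⟩
  change x ∈ D ∧ φ x + κ * |l x| ≤ t ↔
    (x ∈ D ∧ φ x ≤ t - κ * l x) ∧ (x ∈ D ∧ φ x ≤ t + κ * l x)
  constructor
  · rintro ⟨hD, hle⟩
    have h3 := mul_le_mul_of_nonneg_left (le_abs_self (l x)) hκ
    have h4 := mul_le_mul_of_nonneg_left (neg_le_abs (l x)) hκ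
    exact ⟨⟨hD, by linarith⟩, hD, by linarith⟩
  · rintro ⟨⟨hD, h3⟩, -, h4⟩
    refine ⟨hD, ?_⟩
    rcases abs_cases (l x) with ⟨e, -⟩ | ⟨e, -⟩ <;> rw [e] <;> linarith

theorem isPolyhedral_epigraph_add_sum_abs {ι : Type*} {D : Set V} {φ : V → ℝ}
    (h : IsPolyhedral (ExtFun.epigraph ⟨D, φ⟩)) (s : Finset ι) (l : ι → V →ₗ[ℝ] ℝ) {κ : ι → ℝ}
    (hκ : ∀ i, 0 ≤ κ i) :
    IsPolyhedral (ExtFun.epigraph ⟨D, fun x => φ x + ∑ i ∈ s, κ i * |l i x|⟩) := by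
  classical
  induction s using Finset.induction_on with
  | empty => simpa using h
  | insert i s hi ih =>
    have := isPolyhedral_epigraph_add_abs ih (l i) (hκ i)
    simp only [Finset.sum_insert hi]
    convert this using 4
    ring

end Polyhedral

/-! ### Polyhedral level sets reduce the group norm to weighted absolute values. -/

section GroupNorm

variable {n N : ℕ}

theorem sum_eq_add_add_sum_erase_erase {ι : Type*} [DecidableEq ι] (s : Finset ι) {i i' : ι} (hne : i ≠ i')
    (hi : i ∈ s) (hi' : i' ∈ s) (f : ι → ℝ) :
    ∑ k ∈ s, f k = f i + f i' + ∑ k ∈ (s.erase i).erase i', f k := by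
  rw [← Finset.add_sum_erase s f hi,
    ← Finset.add_sum_erase (s.erase i) f (Finset.mem_erase.2 ⟨hne.symm, hi'⟩), add_assoc]

/-- The group norm as a function of two coordinates of the same block. -/
theorem exists_groupNorm_eq (lam : ℝ) (w : Fin N → ℝ) (blk : Fin n → Fin N) {i i' : Fin n}
    (hne : i ≠ i') (hblk : blk i' = blk i) (x₀ : EuclideanSpace ℝ (Fin n)) :
    ∃ C r : ℝ, 0 ≤ C ∧ ∀ x : EuclideanSpace ℝ (Fin n),
      (∀ k, k ≠ i → k ≠ i' → x k = x₀ k) →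
      groupNorm lam w blk x =
        lam * (|x i| + |x i'|) + w (blk i) * √(x i ^ 2 + x i' ^ 2 + C) + r := by
  classical
  refine ⟨∑ k ∈ ((Finset.univ.filter fun k => blk k = blk i).erase i).erase i', x₀ k ^ 2,
    lam * ∑ k ∈ (Finset.univ.erase i).erase i', |x₀ k| +
      ∑ J ∈ Finset.univ.erase (blk i), w J * √(∑ k with blk k = J, x₀ k ^ 2),
    Finset.sum_nonneg fun _ _ => sq_nonneg _, fun x hx => ?_⟩
  have hout : ∀ s : Finset (Fin n), ∀ f : ℝ → ℝ,
      ∑ k ∈ (s.erase i).erase i', f (x k) = ∑ k ∈ (s.erase i).erase i', f (x₀ k) :=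
    fun s f => Finset.sum_congr rfl fun k hk => by
      simp only [Finset.mem_erase] at hk
      rw [hx k hk.2.1 hk.1]
  have h1 : ∑ k, |x k| = |x i| + |x i'| + ∑ k ∈ (Finset.univ.erase i).erase i', |x₀ k| := by
    rw [sum_eq_add_add_sum_erase_erase _ hne (Finset.mem_univ _) (Finset.mem_univ _),
      hout _ fun t => |t|]
  have h2 : ∑ k with blk k = blk i, x k ^ 2 = x i ^ 2 + x i' ^ 2 +
      ∑ k ∈ ((Finset.univ.filter fun k => blk k = blk i).erase i).erase i', x₀ k ^ 2 := by
    rw [sum_eq_add_add_sum_erase_erase _ hne (by simp) (by simp [hblk]), hout _ fun t => t ^ 2]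
  have h3 : ∑ J ∈ Finset.univ.erase (blk i), w J * √(∑ k with blk k = J, x k ^ 2) =
      ∑ J ∈ Finset.univ.erase (blk i), w J * √(∑ k with blk k = J, x₀ k ^ 2) := by
    refine Finset.sum_congr rfl fun J hJ => ?_
    congr 2
    refine Finset.sum_congr rfl fun k hk => ?_
    have hJ' : J ≠ blk i := Finset.ne_of_mem_erase hJ
    have hk' : blk k = J := by simpa using hk
    rw [hx k]
    · rintro rfl; exact hJ' hk'.symm
    · rintro rfl; exact hJ' (hk'.symm.trans hblk)
  rw [groupNorm, h1, ← Finset.add_sum_erase _ _ (Finset.mem_univ (blk i)), h2, h3]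
  ring

/-- If the level sets of `P` plus a group norm are polyhedral, then two coordinates never share
a block of positive weight. -/
theorem false_of_isPolyhedral_level {h P : ExtFun (EuclideanSpace ℝ (Fin n))} {lam : ℝ}
    {w : Fin N → ℝ} {blk : Fin n → Fin N} (hP : IsPolyhedral P.epigraph) (hlam : 0 ≤ lam)
    (hdom : h.dom = P.dom) (hval : ∀ x ∈ h.dom, h.val x = P.val x + groupNorm lam w blk x)
    (hconv : ConvexOn ℝ h.dom h.val) (hcont : ContinuousOn h.val h.dom)
    (hint : (interior h.dom).Nonempty) (hlevel : ∀ ξ, IsPolyhedral (h.level ξ))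
    {i i' : Fin n} (hne : i ≠ i') (hblk : blk i' = blk i) (hw : 0 < w (blk i)) : False := by
  obtain ⟨xh, hxh⟩ := hint
  set e : EuclideanSpace ℝ (Fin n) := EuclideanSpace.single i 1 with he
  set e' : EuclideanSpace ℝ (Fin n) := EuclideanSpace.single i' 1 with he'
  -- Both coordinates are set to zero, so that `z` gives the actual coordinates `i`, `i'` of `x₀ + L
  -- z`.
  set x₀ := xh - xh i • e - xh i' • e' with hx₀
  set L : ℝ × ℝ →ₗ[ℝ] EuclideanSpace ℝ (Fin n) :=
    (LinearMap.fst ℝ ℝ ℝ).smulRight e + (LinearMap.snd ℝ ℝ ℝ).smulRight e' with hL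
  have hLap : ∀ z, L z = z.1 • e + z.2 • e' := fun z => rfl
  have hLc : Continuous L := L.continuous_of_finiteDimensional
  have hσi : ∀ z, (x₀ + L z) i = z.1 := fun z => by
    simp [hLap, hx₀, he, he', hne]
  have hσi' : ∀ z, (x₀ + L z) i' = z.2 := fun z => by
    simp [hLap, hx₀, he, he', hne.symm]
  have hσ : ∀ z k, k ≠ i → k ≠ i' → (x₀ + L z) k = x₀ k := fun z k hk hk' => by
    simp [hLap, he, he', hk, hk']
  obtain ⟨C, r, hC, hgn⟩ := exists_groupNorm_eq lam w blk hne hblk x₀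
  obtain ⟨j, a, c, hac⟩ := id hP
  set U : Set (ℝ × ℝ) := {z | x₀ + L z ∈ interior h.dom} with hU
  have hUdom : ∀ z ∈ U, x₀ + L z ∈ h.dom := fun z hz => interior_subset hz
  have hUopen : IsOpen U := isOpen_interior.preimage (by fun_prop : Continuous fun z => x₀ + L z)
  have hUconv : Convex ℝ U := by
    have := (hconv.1.interior.translate_preimage_right x₀).linear_preimage L
    exact this
  have hcomp : ∀ {F : EuclideanSpace ℝ (Fin n) → ℝ}, ConvexOn ℝ h.dom F →
      ConvexOn ℝ U fun z => F (x₀ + L z) := by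
    intro F hF
    refine ⟨hUconv, fun y hy z hz s t hs ht hst => ?_⟩
    have := hF.2 (hUdom y hy) (hUdom z hz) hs ht hst
    convert this using 2
    rw [map_add, map_smul, map_smul]
    calc x₀ + (s • L y + t • L z) = (s + t) • x₀ + (s • L y + t • L z) := by rw [hst, one_smul]
      _ = _ := by module
  refine false_of_isPolyhedral_level_add_sqrt (J := Fin j) (U := U) hUopen
    ⟨(xh i, xh i'), ?_⟩ (φ := fun z => P.val (x₀ + L z) + r) (H := fun z => h.val (x₀ + L z))
    hlam hw hC
    (fun k => (-(a k (0, 1))⁻¹) • (a k).comp ((LinearMap.inl ℝ _ ℝ).comp L))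
    (fun k => (c k - a k (x₀, 0)) / a k (0, 1) + r) ?_ ?_ ?_ (hcomp hconv) ?_ ?_
  · simp only [hU, Set.mem_ofPred_eq, hLap, hx₀]
    convert hxh using 1
    abel
  · exact (hcomp (hdom ▸ ExtFun.convexOn_of_isPolyhedral hP)).add_const r
  · intro z hz
    obtain ⟨k, hk, hv⟩ := ExtFun.exists_active hac (hdom ▸ hUdom z hz)
    refine ⟨k, ?_⟩
    have hs : a k (x₀ + L z, 0) = a k (x₀, 0) + a k (L z, 0) := by
      rw [← map_add]; simp
    simp only [hv, hs, LinearMap.smul_apply, LinearMap.comp_apply, LinearMap.inl_apply,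
      smul_eq_mul]
    ring
  · intro z hz
    simp only [hval _ (hUdom z hz), hgn _ (hσ z), hσi, hσi']
    ring
  · exact hcont.comp (by fun_prop) hUdom
  · intro ξ
    refine ⟨_, (hlevel ξ).preimage_add L x₀, fun z hz => ?_⟩
    exact ⟨fun h => h.2, fun h => ⟨hUdom z hz, h⟩⟩

/-- Blocks of positive weight have at most one coordinate, and `√(t ^ 2) = |t|`. -/
theorem groupNorm_eq_sum_abs (lam : ℝ) {w : Fin N → ℝ} {blk : Fin n → Fin N}
    (hw : ∀ i i', i ≠ i' → blk i' = blk i → w (blk i) = 0) (x : EuclideanSpace ℝ (Fin n)) :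
    groupNorm lam w blk x = ∑ i, (lam + w (blk i)) * |x i| := by
  have h : ∀ J, w J * √(∑ i with blk i = J, x i ^ 2) = ∑ i with blk i = J, w (blk i) * |x i| := by
    intro J
    rcases Finset.eq_empty_or_nonempty (Finset.univ.filter fun i => blk i = J) with h0 | ⟨i, hi⟩
    · rw [h0]; simp
    have hiJ : blk i = J := by simpa using hi
    by_cases hs : ∃ i', i ≠ i' ∧ blk i' = J
    · obtain ⟨i', hne, hi'⟩ := hs
      have h0 : w J = 0 := hiJ ▸ hw i i' hne (hi'.trans hiJ.symm)
      rw [h0, zero_mul]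
      refine (Finset.sum_eq_zero fun k hk => ?_).symm
      have hk' : blk k = J := by simpa using hk
      rw [hk', h0, zero_mul]
    · push Not at hs
      have h1 : (Finset.univ.filter fun i => blk i = J) = {i} := by
        refine Finset.eq_singleton_iff_unique_mem.2 ⟨hi, fun k hk => ?_⟩
        by_contra hki
        exact hs k (Ne.symm hki) (by simpa using hk)
      rw [h1, Finset.sum_singleton, Finset.sum_singleton, Real.sqrt_sq_eq_abs, hiJ]
  rw [groupNorm, Finset.sum_congr rfl fun J _ => h J,
    Finset.sum_fiberwise Finset.univ blk fun i => w (blk i) * |x i|, Finset.mul_sum,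
    ← Finset.sum_add_distrib]
  exact Finset.sum_congr rfl fun i _ => by ring

/-- A function of the admissible form whose domain has interior points and whose level sets are
polyhedral has a polyhedral epigraph. -/
theorem NonsmoothForm.isPolyhedral_epigraph {h : ExtFun (EuclideanSpace ℝ (Fin n))}
    (hform : NonsmoothForm h) (hconv : ConvexOn ℝ h.dom h.val) (hcont : ContinuousOn h.val h.dom)
    (hint : (interior h.dom).Nonempty) (hlevel : ∀ ξ, IsPolyhedral (h.level ξ)) :
    IsPolyhedral h.epigraph := by
  have key : ∀ (P : ExtFun (EuclideanSpace ℝ (Fin n)))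
      (N : ℕ) (lam : ℝ) (w : Fin N → ℝ) (blk : Fin n → Fin N),
      IsPolyhedral P.epigraph → 0 ≤ lam → (∀ J, 0 ≤ w J) →
      h.dom = P.dom → (∀ x ∈ h.dom, h.val x = P.val x + groupNorm lam w blk x) →
      IsPolyhedral h.epigraph := by
    intro P N lam w blk hP hlam hw hdom hval
    have hw0 : ∀ i i', i ≠ i' → blk i' = blk i → w (blk i) = 0 := by
      intro i i' hne hblk
      by_contra h0
      exact false_of_isPolyhedral_level hP hlam hdom hval hconv hcont hint hlevel hne hblk
        (lt_of_le_of_ne (hw _) (Ne.symm h0))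
    have h1 := isPolyhedral_epigraph_add_sum_abs (D := P.dom) (φ := P.val) hP Finset.univ
      (fun i : Fin n => (EuclideanSpace.proj i : EuclideanSpace ℝ (Fin n) →L[ℝ] ℝ).toLinearMap)
      (κ := fun i => lam + w (blk i)) (fun i => add_nonneg hlam (hw _))
    convert h1 using 1
    ext ⟨x, t⟩
    simp only [ExtFun.epigraph, Set.mem_ofPred_eq, hdom]
    refine and_congr_right fun hx => ?_
    rw [hval x (hdom ▸ hx), groupNorm_eq_sum_abs lam hw0]
    rfl
  rcases hform with h1 | ⟨N, lam, w, blk, hlam, hw, hdom, hval⟩ |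
    ⟨P, N, lam, w, blk, hP, hlam, hw, hdom, hval⟩
  · exact h1
  · refine key ⟨Set.univ, fun _ => 0⟩ N lam w blk ?_ hlam hw hdom fun x _ => by simp [hval]
    refine ⟨1, fun _ => LinearMap.snd ℝ _ ℝ, fun _ => 0, ?_⟩
    ext ⟨x, t⟩
    simp [ExtFun.epigraph]
  · exact key P N lam w blk hP hlam hw hdom hval

end GroupNorm

/-! ### Compact polyhedra as convex hulls of finite sets. -/

section Polytope

variable {V : Type*} [NormedAddCommGroup V] [NormedSpace ℝ V]

/-- A compact polyhedral set is the convex hull of finitely many points. -/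
theorem IsPolyhedral.exists_eq_convexHull {S : Set V} (hS : IsPolyhedral S) (hc : IsCompact S) :
    ∃ F : Finset V, convexHull ℝ (F : Set V) = S := by
  have hconv := hS.convex
  obtain ⟨j, a, c, hac⟩ := hS
  have hmem : ∀ x, x ∈ S ↔ ∀ i, c i ≤ a i x := fun x => by rw [hac]; rfl
  -- An extreme point is determined by its active constraints: if `y` has the same ones, `x ± s • (x
  -- - y)` stay in `S` for small `s`. Finiteness follows, and Krein–Milman concludes.
  have hinj : Set.InjOn (fun x => {i | a i x = c i}) (S.extremePoints ℝ) := by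
    intro x hx y hy hxy
    rw [mem_extremePoints] at hx
    have hact : ∀ i, a i x = c i → a i y = c i := fun i hi => (Set.ext_iff.1 hxy i).1 hi
    have hev : ∀ v : V, (∀ i, a i x = c i → a i v = 0) →
        ∀ᶠ s : ℝ in nhdsWithin 0 (Set.Ioi 0), x + s • v ∈ S := by
      intro v hv
      simp only [hmem]
      refine Filter.eventually_all.2 fun i => ?_
      by_cases hi : a i x = c i
      · exact Filter.Eventually.of_forall fun s => by simp [hv i hi, hi]
      · have hlt : c i < a i x + 0 * a i v := by
          simpa using lt_of_le_of_ne ((hmem x).1 hx.1 i) (Ne.symm hi)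
        have hcont : Continuous fun s : ℝ => a i x + s * a i v := by fun_prop
        filter_upwards [((hcont.tendsto 0).eventually_const_lt hlt).filter_mono
          nhdsWithin_le_nhds] with s hs
        rw [map_add, map_smul, smul_eq_mul]
        exact hs.le
    have h1 := hev (x - y) fun i hi => by rw [map_sub, hi, hact i hi, sub_self]
    have h2 := hev (y - x) fun i hi => by rw [map_sub, hi, hact i hi, sub_self]
    obtain ⟨s, ⟨hs1, hs2⟩, hs0 : 0 < s⟩ := ((h1.and h2).and self_mem_nhdsWithin).exists
    have h3 := (hx.2 _ hs1 _ hs2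
      ⟨1 / 2, 1 / 2, by norm_num, by norm_num, by norm_num, by module⟩).1
    have h4 : s • (x - y) = 0 := by simpa using h3
    exact sub_eq_zero.1 ((smul_eq_zero.1 h4).resolve_left hs0.ne')
  have hfin : (S.extremePoints ℝ).Finite := Set.Finite.of_finite_image (Set.toFinite _) hinj
  refine ⟨hfin.toFinset, ?_⟩
  rw [hfin.coe_toFinset, ← (hfin.isClosed_convexHull ℝ).closure_eq]
  exact closure_convexHull_extremePoints hc hconv

/-- The graph of a polyhedral function over a compact polyhedral set lies in a polytope contained
in the epigraph. -/
theorem ExtFun.exists_polytope [FiniteDimensional ℝ V] {φ : ExtFun V}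
    (hφ : IsPolyhedral φ.epigraph) {X : Set V}
    (hX : IsPolyhedral X) (hXc : IsCompact X) :
    ∃ F : Finset (V × ℝ),
      (∀ p ∈ convexHull ℝ (F : Set (V × ℝ)), p.1 ∈ X ∧ p ∈ φ.epigraph) ∧
      ∀ x ∈ X, x ∈ φ.dom → (x, φ.val x) ∈ convexHull ℝ (F : Set (V × ℝ)) := by
  obtain ⟨j, a, c, hac⟩ := id hφ
  -- Dominates `|φ.val|` on the domain, where `φ.val x` is one of these quotients; vertical
  -- constraints contribute `0` because division by zero is zero.
  have hcont : Continuous fun x : V => ∑ i, |(c i - a i (x, 0)) / a i (0, 1)| := by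
    refine continuous_finsetSum _ fun i _ => ?_
    have : Continuous (a i) := (a i).continuous_of_finiteDimensional
    fun_prop
  obtain ⟨T, hT⟩ := hXc.exists_bound_of_continuousOn hcont.continuousOn
  have hbound : ∀ x ∈ X, x ∈ φ.dom → |φ.val x| ≤ T := by
    intro x hx hxd
    obtain ⟨i, -, hi⟩ := ExtFun.exists_active hac hxd
    refine le_trans ?_ ((le_abs_self _).trans (hT x hx))
    rw [hi]
    exact Finset.single_le_sum (f := fun i => |(c i - a i (x, 0)) / a i (0, 1)|)
      (fun i _ => abs_nonneg _) (Finset.mem_univ i)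
  -- The epigraph over `X` cut off at height `T`, compact because `φ` is bounded below by `-T`
  -- there.
  set S : Set (V × ℝ) := (LinearMap.fst ℝ V ℝ ⁻¹' X ∩ φ.epigraph) ∩ {p | -T ≤ -p.2} with hS
  have hSp : IsPolyhedral S :=
    ((hX.preimage _).inter hφ).inter
      ⟨1, fun _ => -LinearMap.snd ℝ V ℝ, fun _ => -T, by ext; simp⟩
  have hSc : IsCompact S := by
    refine (hXc.prod (isCompact_Icc (a := -T) (b := T))).of_isClosed_subset hSp.isClosed ?_
    rintro ⟨x, t⟩ ⟨⟨hx, hd, hle⟩, ht⟩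
    have hx : x ∈ X := hx
    have ht : -T ≤ -t := ht
    have h1 := (abs_le.1 (hbound x hx hd)).1
    exact ⟨hx, h1.trans hle, by linarith⟩
  obtain ⟨F, hF⟩ := hSp.exists_eq_convexHull hSc
  refine ⟨F, fun p hp => ?_, fun x hx hd => ?_⟩
  · rw [hF] at hp
    exact hp.1
  · rw [hF]
    exact ⟨⟨hx, hd, le_rfl⟩, neg_le_neg (abs_le.1 (hbound x hx hd)).2⟩

end Polytope

/-! ### First-order inequalities for the smooth part along segments. -/

section Smooth

variable {H₁ H₂ : Type*} [NormedAddCommGroup H₁] [InnerProductSpace ℝ H₁] [CompleteSpace H₁]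
  [NormedAddCommGroup H₂] [InnerProductSpace ℝ H₂] [CompleteSpace H₂]

theorem hasDerivAt_comp_line (A : H₁ →L[ℝ] H₂) {g : H₂ → ℝ} {x u : H₁} {s : ℝ}
    (hg : DifferentiableAt ℝ g (A (x + s • (u - x)))) :
    HasDerivAt (fun s : ℝ => g (A (x + s • (u - x))))
      ⟪A.adjoint (gradient g (A (x + s • (u - x)))), u - x⟫ s := by
  have h1 : HasDerivAt (fun s : ℝ => A (x + s • (u - x))) (A (u - x)) s := by
    have : HasDerivAt (fun s : ℝ => x + s • (u - x)) (u - x) s := by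
      simpa using ((hasDerivAt_id s).smul_const (u - x)).const_add x
    exact A.hasFDerivAt.comp_hasDerivAt s this
  have h2 := hg.hasGradientAt.hasFDerivAt.comp_hasDerivAt s h1
  rw [ContinuousLinearMap.adjoint_inner_left]
  exact h2

/-- The gradient inequality for a convex function composed with a linear map. -/
theorem ConvexOn.add_inner_adjoint_gradient_le {D : Set H₂} {g : H₂ → ℝ} (hg : ConvexOn ℝ D g)
    (A : H₁ →L[ℝ] H₂) {x u : H₁} (hx : A x ∈ D) (hu : A u ∈ D)
    (hd : DifferentiableAt ℝ g (A x)) :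
    g (A x) + ⟪A.adjoint (gradient g (A x)), u - x⟫ ≤ g (A u) := by
  have h0 : x + (0 : ℝ) • (u - x) = x := by simp
  have h1 : x + (1 : ℝ) • (u - x) = u := by simp
  have hder := hasDerivAt_comp_line A (g := g) (x := x) (u := u) (s := 0) (by rwa [h0])
  have hconv : ConvexOn ℝ (Set.Icc (0 : ℝ) 1) fun s : ℝ => g (A (x + s • (u - x))) := by
    have h := hg.comp_affineMap (AffineMap.lineMap (A x) (A u))
    have e : (g ∘ (AffineMap.lineMap (A x) (A u) : ℝ →ᵃ[ℝ] H₂)) =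
        fun s : ℝ => g (A (x + s • (u - x))) := by
      funext s
      simp [AffineMap.lineMap_apply, add_comm]
    rw [e] at h
    refine h.subset (fun s hs => ?_) (convex_Icc 0 1)
    exact hg.1.lineMap_mem hx hu hs
  have h := hconv.le_slope_of_hasDerivAt (by simp) (by simp) one_pos hder
  rw [slope_def_field, sub_zero, div_one, h0, h1] at h
  linarith

/-- The quadratic upper bound for a function with Lipschitz gradient along a segment. -/
theorem le_add_inner_adjoint_gradient_add_sq (A : H₁ →L[ℝ] H₂) {g : H₂ → ℝ} {X : Set H₁}
    (hX : Convex ℝ X) (hd : ∀ x ∈ X, DifferentiableAt ℝ g (A x)) {L R : ℝ} (hL : 0 ≤ L)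
    (hlip : ∀ x ∈ X, ∀ x' ∈ X, ‖A.adjoint (gradient g (A x)) - A.adjoint (gradient g (A x'))‖ ≤
      L * ‖x - x'‖) {x u : H₁} (hx : x ∈ X) (hu : u ∈ X) (hR : ‖u - x‖ ≤ R) {s : ℝ}
    (hs0 : 0 ≤ s) (hs1 : s ≤ 1) :
    g (A (x + s • (u - x))) ≤ g (A x) + s * ⟪A.adjoint (gradient g (A x)), u - x⟫ +
      L * R ^ 2 * s ^ 2 := by
  rcases hs0.eq_or_lt with rfl | hs
  · simp
  have hmem : ∀ t : ℝ, 0 ≤ t → t ≤ 1 → x + t • (u - x) ∈ X := fun t h0 h1 =>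
    hX.add_smul_sub_mem hx hu ⟨h0, h1⟩
  have hder : ∀ t : ℝ, 0 ≤ t → t ≤ 1 → HasDerivAt (fun s : ℝ => g (A (x + s • (u - x))))
      ⟪A.adjoint (gradient g (A (x + t • (u - x)))), u - x⟫ t := fun t h0 h1 =>
    hasDerivAt_comp_line A (hd _ (hmem t h0 h1))
  -- The mean value theorem suffices; it gives the constant `L * R ^ 2` without the usual factor one
  -- half.
  obtain ⟨t, ht, he⟩ := exists_hasDerivAt_eq_slope (fun s : ℝ => g (A (x + s • (u - x))))
    (fun t => ⟪A.adjoint (gradient g (A (x + t • (u - x)))), u - x⟫) hs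
    (fun t ht => (hder t ht.1 (ht.2.trans hs1)).continuousAt.continuousWithinAt)
    (fun t ht => hder t ht.1.le (ht.2.le.trans hs1))
  simp only [zero_smul, add_zero, sub_zero] at he
  rw [eq_div_iff hs.ne'] at he
  have h1 := hlip _ (hmem t ht.1.le (ht.2.le.trans hs1)) x hx
  rw [add_sub_cancel_left, norm_smul, Real.norm_eq_abs, abs_of_pos ht.1] at h1
  have h2 : ⟪A.adjoint (gradient g (A (x + t • (u - x)))), u - x⟫ -
      ⟪A.adjoint (gradient g (A x)), u - x⟫ ≤ L * R ^ 2 * s := by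
    rw [← inner_sub_left]
    calc _ ≤ _ := real_inner_le_norm _ _
      _ ≤ (L * (t * ‖u - x‖)) * ‖u - x‖ := by gcongr
      _ = L * ‖u - x‖ ^ 2 * t := by ring
      _ ≤ L * R ^ 2 * s := by
        have := ht.2.le
        have := ht.1.le
        gcongr
  nlinarith

end Smooth

/-! ### Epigraph reformulation of the block problem. -/

namespace BlockProblem

variable {K m : ℕ} {n p : Fin K → ℕ} {Q : BlockProblem K m n p}

theorem Assumptions.interior_dom_h_nonempty (hA : Q.Assumptions) (k : Fin K) :
    (interior (Q.h k).dom).Nonempty := by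
  obtain ⟨x, ⟨-, hx⟩, -⟩ := hA.qualification
  refine ⟨x k, mem_interior.2 ⟨Function.eval k '' interior Q.f.dom, ?_,
    isOpenMap_eval k _ isOpen_interior, ⟨x, hx, rfl⟩⟩⟩
  rintro _ ⟨z, hz, rfl⟩
  exact (interior_subset hz k).2

/-- Freezing the other blocks at a point of the domain exhibits a level set of `h_k` as an affine
slice of one of `h`. -/
theorem Assumptions.isPolyhedral_level (hA : Q.Assumptions)
    (hlevel : ∀ ξ : ℝ, IsPolyhedral (Q.hSum.level ξ)) (k : Fin K) (ξ : ℝ) :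
    IsPolyhedral ((Q.h k).level ξ) := by
  obtain ⟨x, ⟨-, hx⟩, -⟩ := hA.qualification
  have hxd : ∀ k, x k ∈ (Q.h k).dom := fun k => (interior_subset hx k).2
  set r := ∑ l ∈ Finset.univ.erase k, (Q.h l).val (x l) with hr
  have h := (hlevel (ξ + r)).preimage_add
    (LinearMap.single ℝ (fun k => EuclideanSpace ℝ (Fin (n k))) k) (Function.update x k 0)
  convert h using 1
  ext z
  have hu : Function.update x k 0 +
      LinearMap.single ℝ (fun k => EuclideanSpace ℝ (Fin (n k))) k z = Function.update x k z := by
    funext l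
    rcases eq_or_ne l k with rfl | hl
    · simp
    · simp [hl]
  have hv : Q.hSum.val (Function.update x k z) = (Q.h k).val z + r := by
    simp only [hSum]
    rw [← Finset.add_sum_erase _ _ (Finset.mem_univ k), Function.update_self, hr]
    congr 1
    refine Finset.sum_congr rfl fun l hl => ?_
    rw [Function.update_of_ne (Finset.ne_of_mem_erase hl)]
  have hd : Function.update x k z ∈ Q.hSum.dom ↔ z ∈ (Q.h k).dom := by
    constructor
    · intro h
      simpa using h k
    · intro h l
      rcases eq_or_ne l k with rfl | hl
      · simpa using h
      · simpa [hl] using hxd l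
  simp only [Set.mem_ofPred_eq, hu, ExtFun.level, hv, hd, add_le_add_iff_right]

theorem Assumptions.isPolyhedral_epigraph (hA : Q.Assumptions)
    (hlevel : ∀ ξ : ℝ, IsPolyhedral (Q.hSum.level ξ)) (k : Fin K) :
    IsPolyhedral (Q.h k).epigraph :=
  (hA.nonsmooth_h k).isPolyhedral_epigraph (hA.convex_h k) (hA.continuous_h k)
    (hA.interior_dom_h_nonempty k) (hA.isPolyhedral_level hlevel k)

theorem Assumptions.differentiableAt_g (hA : Q.Assumptions) {k : Fin K}
    {x : EuclideanSpace ℝ (Fin (n k))} (hx : x ∈ Q.X k) :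
    DifferentiableAt ℝ (Q.g k).val (Q.A k x) :=
  ((hA.contDiff_g k).differentiableOn one_ne_zero).differentiableAt
    (isOpen_interior.mem_nhds (hA.map_X k x hx))

/-- The objective of the epigraph reformulation, in the variables `z k = (x k, t k)`. -/
noncomputable def liftF (Q : BlockProblem K m n p) (z : ∀ k, EuclideanSpace ℝ (Fin (n k)) × ℝ) :
    ℝ := ∑ k, ((Q.g k).val (Q.A k (z k).1) + (z k).2)

/-- The derivative of `liftF`. -/
noncomputable def liftDF (Q : BlockProblem K m n p) (z : ∀ k, EuclideanSpace ℝ (Fin (n k)) × ℝ) :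
    (∀ k, EuclideanSpace ℝ (Fin (n k)) × ℝ) →ₗ[ℝ] ℝ :=
  ∑ k, ((innerₗ _ ((Q.A k).adjoint (gradient (Q.g k).val (Q.A k (z k).1)))).comp
    (LinearMap.fst ℝ _ ℝ) + LinearMap.snd ℝ _ ℝ).comp (LinearMap.proj k)

/-- The constraint map in the lifted variables. -/
noncomputable def liftE (Q : BlockProblem K m n p) :
    (∀ k, EuclideanSpace ℝ (Fin (n k)) × ℝ) →ₗ[ℝ] EuclideanSpace ℝ (Fin m) :=
  ∑ k, ((Q.E k).toLinearMap.comp (LinearMap.fst ℝ _ ℝ)).comp (LinearMap.proj k)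

theorem liftDF_apply (z w : ∀ k, EuclideanSpace ℝ (Fin (n k)) × ℝ) :
    Q.liftDF z w = ∑ k, (⟪(Q.A k).adjoint (gradient (Q.g k).val (Q.A k (z k).1)), (w k).1⟫ +
      (w k).2) := by
  simp [liftDF]

theorem liftE_apply (z : ∀ k, EuclideanSpace ℝ (Fin (n k)) × ℝ) :
    Q.liftE z = Q.Ex fun k => (z k).1 := by
  simp [liftE, Ex]

/-- The epigraph reformulation is a smooth convex program over a polytope whose augmented dual
function is that of the original problem. -/
theorem Assumptions.exists_polytopeProgram (hA : Q.Assumptions) (hρ : 0 < Q.ρ)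
    (hlevel : ∀ ξ : ℝ, IsPolyhedral (Q.hSum.level ξ)) :
    ∃ T : PolytopeProgram (∀ k, EuclideanSpace ℝ (Fin (n k)) × ℝ) (EuclideanSpace ℝ (Fin m)),
      T.IsDual Q.dual := by
  classical
  have h := fun k => ExtFun.exists_polytope (hA.isPolyhedral_epigraph hlevel k)
    (hA.polyhedral_X k) (hA.compact_X k)
  choose V hV1 hV2 using h
  set VV : Finset (∀ k, EuclideanSpace ℝ (Fin (n k)) × ℝ) := Fintype.piFinset V with hVV
  have hmem : ∀ z, z ∈ convexHull ℝ (VV : Set (∀ k, EuclideanSpace ℝ (Fin (n k)) × ℝ)) ↔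
      ∀ k, z k ∈ convexHull ℝ (V k : Set (EuclideanSpace ℝ (Fin (n k)) × ℝ)) := fun z => by
    rw [hVV, Fintype.coe_piFinset, convexHull_pi]
    simp
  obtain ⟨L, hL, hlip⟩ := hA.lipschitz_g
  have hdiam : ∀ k, ∃ R : ℝ, ∀ x ∈ Q.X k, ∀ u ∈ Q.X k, ‖u - x‖ ≤ R := fun k => by
    obtain ⟨R, hR⟩ := (hA.compact_X k).isBounded.exists_norm_le
    exact ⟨R + R, fun x hx u hu => (norm_sub_le _ _).trans (add_le_add (hR u hu) (hR x hx))⟩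
  choose R hR using hdiam
  let T : PolytopeProgram (∀ k, EuclideanSpace ℝ (Fin (n k)) × ℝ) (EuclideanSpace ℝ (Fin m)) :=
    { V := VV
      E := Q.liftE
      q := Q.q
      ρ := Q.ρ
      F := Q.liftF
      DF := Q.liftDF
      -- The `1` keeps the constant positive when the sum vanishes, for instance if `K = 0`.
      M := ∑ k, L * R k ^ 2 + 1
      ρ_pos := hρ
      M_pos := by positivity
      add_le := by
        intro z hz w hw
        rw [hmem] at hz hw
        rw [liftDF_apply, liftF, liftF, ← Finset.sum_add_distrib]
        refine Finset.sum_le_sum fun k _ => ?_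
        have hx := (hV1 k _ (hz k)).1
        have hu := (hV1 k _ (hw k)).1
        have h1 := (hA.convex_g k).add_inner_adjoint_gradient_le (Q.A k)
          (interior_subset (hA.map_X k _ hx)) (interior_subset (hA.map_X k _ hu))
          (hA.differentiableAt_g hx)
        simp only [Pi.sub_apply, Prod.fst_sub, Prod.snd_sub]
        linarith
      le_add := by
        intro z hz w hw s hs0 hs1
        rw [hmem] at hz hw
        have h1 : ∑ k, ((Q.g k).val (Q.A k (z k + s • (w k - z k)).1) + (z k + s • (w k - z k)).2)
            ≤ ∑ k, ((Q.g k).val (Q.A k (z k).1) + (z k).2 +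
              s * (⟪(Q.A k).adjoint (gradient (Q.g k).val (Q.A k (z k).1)), (w k - z k).1⟫ +
                (w k - z k).2) + L * R k ^ 2 * s ^ 2) := by
          refine Finset.sum_le_sum fun k _ => ?_
          have hx := (hV1 k _ (hz k)).1
          have hu := (hV1 k _ (hw k)).1
          have h1 := le_add_inner_adjoint_gradient_add_sq (Q.A k) (hA.polyhedral_X k).convex
            (fun x hx => hA.differentiableAt_g hx) hL.le (hlip k) hx hu (hR k _ hx _ hu) hs0 hs1
          simp only [Prod.fst_sub, Prod.snd_sub, Prod.fst_add, Prod.snd_add, Prod.smul_fst,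
            Prod.smul_snd, smul_eq_mul]
          linarith
        rw [liftDF_apply]
        refine h1.trans ?_
        rw [Finset.sum_add_distrib, Finset.sum_add_distrib, ← Finset.mul_sum, ← Finset.sum_mul]
        have : 0 ≤ s ^ 2 := sq_nonneg s
        simp only [liftF, Pi.sub_apply]
        linarith }
  have hTC : ∀ z, z ∈ T.C ↔
      ∀ k, z k ∈ convexHull ℝ (V k : Set (EuclideanSpace ℝ (Fin (n k)) × ℝ)) := hmem
  have hfeas : ∀ x : Var n, x ∈ Q.feas ∩ Q.f.dom →
      (fun k => (x k, (Q.h k).val (x k))) ∈ T.C := fun x hx =>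
    (hTC _).2 fun k => hV2 k _ (hx.1 k) (hx.2 k).2
  have hlagr : ∀ (x : Var n) y, T.augL (fun k => (x k, (Q.h k).val (x k))) y = Q.lagr x y := by
    intro x y
    simp only [PolytopeProgram.augL, lagr, T, liftE_apply, liftF, f]
  have hdom : ∀ z ∈ T.C, (fun k => (z k).1) ∈ Q.feas ∩ Q.f.dom := by
    intro z hz
    rw [hTC] at hz
    exact ⟨fun k => (hV1 k _ (hz k)).1, fun k =>
      ⟨interior_subset (hA.map_X k _ (hV1 k _ (hz k)).1), (hV1 k _ (hz k)).2.1⟩⟩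
  -- Replacing `t_k` by `h_k(x_k)` can only lower the objective; with `hlagr` this makes the two
  -- minimal values equal.
  have hle : ∀ z ∈ T.C, ∀ y, Q.lagr (fun k => (z k).1) y ≤ T.augL z y := by
    intro z hz y
    rw [hTC] at hz
    simp only [PolytopeProgram.augL, lagr, T, liftE_apply, liftF, f]
    gcongr with k
    exact (hV1 k _ (hz k)).2.2
  have hcompact : IsCompact T.C := T.V.finite_toSet.isCompact_convexHull ℝ
  have hne : T.C.Nonempty := by
    obtain ⟨x, ⟨hx1, hx2⟩, -⟩ := hA.qualification
    exact ⟨_, hfeas x ⟨hx1, interior_subset hx2⟩⟩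
  have hFc : ContinuousOn Q.liftF T.C := by
    refine continuousOn_finsetSum _ fun k _ => ContinuousOn.add ?_ (by fun_prop)
    refine (hA.continuous_g k).comp (by fun_prop) fun z hz => ?_
    exact ((hdom z hz).2 k).1
  have hEc : Continuous Q.liftE := Q.liftE.continuous_of_finiteDimensional
  refine ⟨T, fun y => ?_⟩
  have hcont : ContinuousOn (fun z => T.augL z y) T.C := by
    refine (hFc.add ?_).add ?_
    · exact (continuous_const.inner (continuous_const.sub hEc)).continuousOn
    · exact (((continuous_const.sub hEc).norm.pow 2).const_mul _).continuousOn
  obtain ⟨z, hz, hmin⟩ := hcompact.exists_isMinOn hne hcont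
  refine ⟨z, ⟨hz, fun w hw => hmin hw⟩, ?_⟩
  have hlow : ∀ x ∈ Q.feas ∩ Q.f.dom, T.augL z y ≤ Q.lagr x y := fun x hx =>
    (hmin (hfeas x hx)).trans_eq (hlagr x y)
  refine IsLeast.csInf_eq ⟨⟨_, hdom z hz, le_antisymm (hle z hz y) (hlow _ (hdom z hz))⟩, ?_⟩
  rintro _ ⟨x, hx, rfl⟩
  exact hlow x hx

end BlockProblem

theorem claim6p1 {K m : ℕ} {n p : Fin K → ℕ} (Q : BlockProblem K m n p)
    (hρ : 0 < Q.ρ) (hA : Q.Assumptions)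
    (hlevel : ∀ ξ : ℝ, IsPolyhedral (Q.hSum.level ξ)) (η : ℝ) :
    Differentiable ℝ Q.dual ∧
    ∃ δ τ : ℝ, 0 < δ ∧ 0 < τ ∧
      ∀ y ∈ Q.dualLevel η, ‖gradient Q.dual y‖ ≤ δ →
        Metric.infDist y Q.dualOpt ≤ τ * ‖gradient Q.dual y‖ := by
  obtain ⟨T, hd⟩ := hA.exists_polytopeProgram hρ hlevel
  refine ⟨fun y => ?_, hd.exists_error_bound hA.dual_attained η⟩
  obtain ⟨z, hz, -⟩ := hd y
  exact (hd.hasGradientAt hz).hasFDerivAt.differentiableAt
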